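/- Let $\mathcal G$ be a finite network: a finite directed graph with vertex set $\mathsf V$ and nonempty edge set $\mathsf E$, each edge $\mathsf e$ being identified with an interval $(0,\ell_{\mathsf e})$, $0<\ell_{\mathsf e}<\infty$, so that $0$ corresponds to its initial and $\ell_{\mathsf e}$ to its terminal endpoint. For each $\mathsf e$ let $k_{\mathsf e}\ge 1$ be an integer and let $M_{\mathsf e},N_{\mathsf e},Q_{\mathsf e}:[0,\ell_{\mathsf e}]\to\mathbb C^{k_{\mathsf e}\times k_{\mathsf e}}$ be such that - $M_{\mathsf e}$ is Lipschitz continuous and $M_{\mathsf e}(x)$ is invertible for all $x\in[0,\ell_{\mathsf e}]$; - $N_{\mathsf e}\in L^\infty$; - $Q_{\mathsf e}$ is Lipschitz continuous, $Q_{\mathsf e}(x)$ and $Q_{\mathsf e}(x)M_{\mathsf e}(x)$ are Hermitian for all $x\in[0,\ell_{\mathsf e}]$, and there is $q>0$ with $Q_{\mathsf e}(x)\xi\cdot\bar\xi\ge q\|\xi\|^2$ for all $\xi\in\mathbb C^{k_{\mathsf e}}$ and $x\in[0,\ell_{\mathsf e}]$. Equip $\mathbf L^2(\mathcal G):=\bigoplus_{\mathsf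 e}L^2(0,\ell_{\mathsf e})^{k_{\mathsf e}}$ with the inner product $(u,v):=\sum_{\mathsf e}\int_0^{\ell_{\mathsf e}}Q_{\mathsf e}u_{\mathsf e}\cdot\bar v_{\mathsf e}\,dx$, which is equivalent to the canonical one. For $\mathsf v\in\mathsf V$ let $\mathsf E_{\mathsf v}$ be the set of edges incident in $\mathsf v$ (a loop at $\mathsf v$ is counted twice, once for each of its two ends), put $k_{\mathsf v}:=\sum_{\mathsf e\in\mathsf E_{\mathsf v}}k_{\mathsf e}$, let $\gamma_{\mathsf v}(u):=(u_{\mathsf e}(\mathsf v))_{\mathsf e\in\mathsf E_{\mathsf v}}\in\mathbb C^{k_{\mathsf v}}$ be the vector of boundary values at $\mathsf v$ of $u\in\bigoplus_{\mathsf e}H^1(0,\ell_{\mathsf e})^{k_{\mathsf e}}$, let $T_{\mathsf v}:=\operatorname{diag}\big(\iota_{\mathsf v\mathsf e}\,Q_{\mathsf e}(\mathsf v)M_{\mathsf e}(\mathsf v)\big)_{\mathsf e\in\mathsf E_{\mathsf v}}$, where $\iota_{\mathsf v\mathsf e}=-1$ if $\mathsf v$ is the initial endpoint of $\mathsf e$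 and $\iota_{\mathsf v\mathsf e}=+1$ if it is the terminal endpoint, and let $q_{\mathsf v}(\xi):=T_{\mathsf v}\xi\cdot\bar\xi$ for $\xi\in\mathbb C^{k_{\mathsf v}}$. A subspace of $\mathbb C^{k_{\mathsf v}}$ is called totally isotropic for $q_{\mathsf v}$ if $q_{\mathsf v}$ vanishes on it. For each $\mathsf v\in\mathsf V$ let $Y_{\mathsf v}$ be a subspace of $\mathbb C^{k_{\mathsf v}}$ with orthogonal complement $Y_{\mathsf v}^\perp$ for the Euclidean inner product, and suppose that both $Y_{\mathsf v}$ and $T_{\mathsf v}^{-1}Y_{\mathsf v}^\perp$ are totally isotropic for $q_{\mathsf v}$. Let $\mathcal A$ be the operator on $\mathbf L^2(\mathcal G)$ given by $$(\mathcal A u)_{\mathsf e}:=M_{\mathsf e}u_{\mathsf e}'+N_{\mathsf e}u_{\mathsf e},\qquad D(\mathcal A):=\Big\{u\in\bigoplus_{\mathsf e}H^1(0,\ell_{\mathsf e})^{k_{\mathsf e}}:\ \gamma_{\mathsf v}(u)\in Y_{\mathsf v}\text{ for all }\mathsf v\in\mathsf V\Big\}.$$ Then both $\mathcal A$ and $-\mathcal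 A$ are quasi-$m$-dissipative with respect to $(\cdot,\cdot)$, i.e. for each $\mathcal B\in\{\mathcal A,-\mathcal A\}$ there is $\omega\in\mathbb R$ such that $\operatorname{Re}(\mathcal Bu,u)\le\omega(u,u)$ for all $u\in D(\mathcal A)$ and $\lambda-\mathcal B$ maps $D(\mathcal A)$ onto $\mathbf L^2(\mathcal G)$ for all real $\lambda>\omega$. Both $\mathcal A$ and $-\mathcal A$ generate strongly continuous semigroups, and $\mathcal A$ generates a strongly continuous group on $\mathbf L^2(\mathcal G)$. If, additionally, $Q_{\mathsf e}N_{\mathsf e}+(Q_{\mathsf e}N_{\mathsf e})^*=(Q_{\mathsf e}M_{\mathsf e})'$ holds a.e. on $(0,\ell_{\mathsf e})$ for every $\mathsf e\in\mathsf E$, then this group is unitary with respect to $(\cdot,\cdot)$. -/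

import Mathlib

open MeasureTheory Set Filter Topology
open scoped NNReal ENNReal ContDiff Matrix Matrix.Norms.L2Operator

noncomputable section

/-! ### Strongly continuous semigroups and groups, generators, quasi-m-dissipativity -/

/-- A strongly continuous one-parameter semigroup of bounded operators on `X`. -/
structure C0Semigroup (X : Type*) [NormedAddCommGroup X] [NormedSpace ℂ X] where
  op : ℝ≥0 → X →L[ℂ] X
  op_zero : op 0 = 1
  op_add : ∀ s t, op (s + t) = op s * op t
  continuous_op : ∀ x, Continuous fun t => op t x

/-- A strongly continuous one-parameter group of bounded operators on `X`. -/
structure C0Group (X : Type*) [NormedAddCommGroup X] [NormedSpace ℂ X] where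
  op : ℝ → X →L[ℂ] X
  op_zero : op 0 = 1
  op_add : ∀ s t, op (s + t) = op s * op t
  continuous_op : ∀ x, Continuous fun t => op t x

/-- `A` is the generator of the semigroup `S`: its graph consists of all pairs `(x, y)` such that
the right derivative of `t ↦ S t x` at `0` exists and equals `y`. -/
def C0Semigroup.IsGenerator {X : Type*} [NormedAddCommGroup X] [NormedSpace ℂ X]
    (S : C0Semigroup X) (A : X →ₗ.[ℂ] X) : Prop :=
  ∀ x y : X, (x, y) ∈ A.graph ↔
    Tendsto (fun t : ℝ≥0 => ((t : ℝ) : ℂ)⁻¹ • (S.op t x - x)) (𝓝[>] 0) (𝓝 y)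

/-- `A` is the generator of the group `S`: its graph consists of all pairs `(x, y)` such that
the (two-sided) derivative of `t ↦ S t x` at `0` exists and equals `y`. -/
def C0Group.IsGenerator {X : Type*} [NormedAddCommGroup X] [NormedSpace ℂ X]
    (S : C0Group X) (A : X →ₗ.[ℂ] X) : Prop :=
  ∀ x y : X, (x, y) ∈ A.graph ↔
    Tendsto (fun t : ℝ => (t : ℂ)⁻¹ • (S.op t x - x)) (𝓝[≠] 0) (𝓝 y)

/-- The operator `A` is quasi-m-dissipative with respect to the inner product `B` (linear in its
first argument): for some real `a`, the operator `A - a` is dissipative and `r - A` is surjective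
for every real `r > a`. -/
def IsQuasiMDissipative {X : Type*} [AddCommGroup X] [Module ℂ X]
    (B : X → X → ℂ) (A : X →ₗ.[ℂ] X) : Prop :=
  ∃ a : ℝ, (∀ u : A.domain, (B (A u) u).re ≤ a * (B u u).re) ∧
    ∀ r : ℝ, a < r → ∀ f : X, ∃ u : A.domain, (r : ℂ) • (u : X) - A u = f

/-! ### Square integrable and Sobolev functions on an interval -/

/-- `L²(0, ℓ)ⁿ` -/
abbrev IntervalL2 (ℓ : ℝ) (n : ℕ) : Type :=
  Lp (EuclideanSpace ℂ (Fin n)) 2 (volume.restrict (Ioo (0 : ℝ) ℓ))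

/-- A matrix acting on a vector of `ℂⁿ`, as a bounded operator for the Euclidean norm. -/
abbrev matOp {ι : Type*} [Fintype ι] [DecidableEq ι] (A : Matrix ι ι ℂ) :
    EuclideanSpace ℂ ι →L[ℂ] EuclideanSpace ℂ ι :=
  Matrix.toEuclideanCLM (n := ι) (𝕜 := ℂ) A

theorem aestronglyMeasurable_clm_apply {α E F : Type*} [MeasurableSpace α] {μ : Measure α}
    [NormedAddCommGroup E] [NormedSpace ℂ E] [NormedAddCommGroup F] [NormedSpace ℂ F]
    {f : α → E →L[ℂ] F} {g : α → E}
    (hf : AEStronglyMeasurable f μ) (hg : AEStronglyMeasurable g μ) :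
    AEStronglyMeasurable (fun x => f x (g x)) μ :=
  (isBoundedBilinearMap_apply (𝕜 := ℂ) (E := E) (F := F)).continuous.comp_aestronglyMeasurable
    (hf.prodMk hg)

theorem memLp_matOp {ℓ : ℝ} {n : ℕ} {A : ℝ → Matrix (Fin n) (Fin n) ℂ}
    (hA : MemLp A ∞ (volume.restrict (Ioo (0 : ℝ) ℓ))) (u : IntervalL2 ℓ n) :
    MemLp (fun x => matOp (A x) (u x)) 2 (volume.restrict (Ioo (0 : ℝ) ℓ)) := by
  have hc : Continuous (fun B : Matrix (Fin n) (Fin n) ℂ => matOp B) :=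
    (AddMonoidHomClass.isometry_of_norm
      (Matrix.toEuclideanCLM (n := Fin n) (𝕜 := ℂ)) (fun _ => rfl)).continuous
  have h1 : AEStronglyMeasurable (fun x => matOp (A x)) (volume.restrict (Ioo (0 : ℝ) ℓ)) :=
    hc.comp_aestronglyMeasurable hA.aestronglyMeasurable
  have hm := aestronglyMeasurable_clm_apply h1 (Lp.memLp u).aestronglyMeasurable
  refine MemLp.of_le_mul (c := (eLpNormEssSup A (volume.restrict (Ioo (0 : ℝ) ℓ))).toReal)
    (Lp.memLp u) hm ?_
  have hfin : eLpNormEssSup A (volume.restrict (Ioo (0 : ℝ) ℓ)) ≠ (⊤ : ℝ≥0∞) := by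
    simpa using hA.2.ne
  filter_upwards [ae_le_eLpNormEssSup (f := A) (μ := volume.restrict (Ioo (0 : ℝ) ℓ))] with x hx
  refine ((matOp (A x)).le_opNorm (u x)).trans (mul_le_mul_of_nonneg_right ?_ (norm_nonneg _))
  have := ENNReal.toReal_mono hfin hx
  rwa [toReal_enorm] at this

/-- Multiplication of `u ∈ L²(0, ℓ)ⁿ` by an essentially bounded matrix-valued function. -/
def mulL2 {ℓ : ℝ} {n : ℕ} (A : ℝ → Matrix (Fin n) (Fin n) ℂ)
    (hA : MemLp A ∞ (volume.restrict (Ioo (0 : ℝ) ℓ))) :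
    IntervalL2 ℓ n →ₗ[ℂ] IntervalL2 ℓ n where
  toFun u := (memLp_matOp hA u).toLp _
  map_add' u v := by
    rw [← MemLp.toLp_add, MemLp.toLp_eq_toLp_iff]
    filter_upwards [Lp.coeFn_add u v] with x hx
    rw [Pi.add_apply, hx, Pi.add_apply, map_add]
  map_smul' c u := by
    rw [RingHom.id_apply, ← MemLp.toLp_const_smul, MemLp.toLp_eq_toLp_iff]
    filter_upwards [Lp.coeFn_smul c u] with x hx
    rw [Pi.smul_apply, hx, Pi.smul_apply, map_smul]

/-- `g ∈ L²(0, ℓ)ⁿ` is the weak derivative of `u ∈ L²(0, ℓ)ⁿ` on `(0, ℓ)`. -/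
def IsWeakDeriv {ℓ : ℝ} {n : ℕ} (u g : IntervalL2 ℓ n) : Prop :=
  ∀ φ : ℝ → ℝ, ContDiff ℝ ∞ φ → HasCompactSupport φ → tsupport φ ⊆ Ioo 0 ℓ →
    ∫ x in Ioo 0 ℓ, deriv φ x • u x = - ∫ x in Ioo 0 ℓ, φ x • g x

theorem integrable_smul_L2 {ℓ : ℝ} {n : ℕ} (u : IntervalL2 ℓ n) {φ : ℝ → ℝ}
    (hφ : Continuous φ) (hc : HasCompactSupport φ) :
    Integrable (fun x => φ x • u x) (volume.restrict (Ioo (0 : ℝ) ℓ)) := by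
  obtain ⟨C, hC⟩ := hφ.bounded_above_of_compact_support hc
  exact ((Lp.memLp u).integrable one_le_two).bdd_smul C hφ.aestronglyMeasurable
    (Eventually.of_forall hC)

theorem IsWeakDeriv.add {ℓ : ℝ} {n : ℕ} {u g v h : IntervalL2 ℓ n}
    (hu : IsWeakDeriv u g) (hv : IsWeakDeriv v h) : IsWeakDeriv (u + v) (g + h) := by
  intro φ h1 h2 h3
  have hd : Continuous (deriv φ) := h1.continuous_deriv (by simp)
  have e1 : ∫ x in Ioo 0 ℓ, deriv φ x • (u + v) x =
      ∫ x in Ioo 0 ℓ, (deriv φ x • u x + deriv φ x • v x) := by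
    refine integral_congr_ae ?_
    filter_upwards [Lp.coeFn_add u v] with x hx
    rw [hx, Pi.add_apply, smul_add]
  have e2 : ∫ x in Ioo 0 ℓ, φ x • (g + h) x =
      ∫ x in Ioo 0 ℓ, (φ x • g x + φ x • h x) := by
    refine integral_congr_ae ?_
    filter_upwards [Lp.coeFn_add g h] with x hx
    rw [hx, Pi.add_apply, smul_add]
  rw [e1, e2, integral_add (integrable_smul_L2 u hd h2.deriv) (integrable_smul_L2 v hd h2.deriv),
    integral_add (integrable_smul_L2 g h1.continuous h2) (integrable_smul_L2 h h1.continuous h2),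
    hu φ h1 h2 h3, hv φ h1 h2 h3, neg_add]

theorem IsWeakDeriv.smul {ℓ : ℝ} {n : ℕ} {u g : IntervalL2 ℓ n} (c : ℂ)
    (hu : IsWeakDeriv u g) : IsWeakDeriv (c • u) (c • g) := by
  intro φ h1 h2 h3
  have e1 : ∫ x in Ioo 0 ℓ, deriv φ x • (c • u) x = ∫ x in Ioo 0 ℓ, c • (deriv φ x • u x) := by
    refine integral_congr_ae ?_
    filter_upwards [Lp.coeFn_smul c u] with x hx
    rw [hx, Pi.smul_apply, smul_comm]
  have e2 : ∫ x in Ioo 0 ℓ, φ x • (c • g) x = ∫ x in Ioo 0 ℓ, c • (φ x • g x) := by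
    refine integral_congr_ae ?_
    filter_upwards [Lp.coeFn_smul c g] with x hx
    rw [hx, Pi.smul_apply, smul_comm]
  rw [e1, e2, integral_smul, integral_smul, hu φ h1 h2 h3, smul_neg]

theorem IsWeakDeriv.zero {ℓ : ℝ} {n : ℕ} : IsWeakDeriv (0 : IntervalL2 ℓ n) 0 := by
  intro φ h1 h2 h3
  have h0 : ∀ ψ : ℝ → ℝ, ∫ x in Ioo 0 ℓ, ψ x • (0 : IntervalL2 ℓ n) x = 0 := fun ψ => by
    refine integral_eq_zero_of_ae ?_
    filter_upwards [Lp.coeFn_zero (EuclideanSpace ℂ (Fin n)) 2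
      (volume.restrict (Ioo (0 : ℝ) ℓ))] with x hx
    rw [hx, Pi.zero_apply, smul_zero]
  rw [h0, h0, neg_zero]

theorem IsWeakDeriv.unique {ℓ : ℝ} {n : ℕ} {u g h : IntervalL2 ℓ n}
    (hg : IsWeakDeriv u g) (hh : IsWeakDeriv u h) : g = h := by
  have hd : IsWeakDeriv (0 : IntervalL2 ℓ n) (g - h) := by
    have := hg.add (hh.smul (-1))
    simpa [sub_eq_add_neg] using this
  rw [← sub_eq_zero]
  set d := g - h with hdd
  have hloc : LocallyIntegrableOn (d : ℝ → EuclideanSpace ℂ (Fin n)) (Ioo 0 ℓ) volume :=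
    IntegrableOn.locallyIntegrableOn ((Lp.memLp d).integrable one_le_two)
  have key := isOpen_Ioo.ae_eq_zero_of_integral_contDiff_smul_eq_zero hloc (by
    intro φ h1 h2 h3
    have h4 := hd φ h1 h2 h3
    have h5 : ∫ x in Ioo 0 ℓ, deriv φ x • (0 : IntervalL2 ℓ n) x = 0 := by
      refine integral_eq_zero_of_ae ?_
      filter_upwards [Lp.coeFn_zero (EuclideanSpace ℂ (Fin n)) 2
        (volume.restrict (Ioo (0 : ℝ) ℓ))] with x hx
      rw [hx, Pi.zero_apply, smul_zero]
    rw [h5, eq_comm, neg_eq_zero] at h4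
    rw [← h4, setIntegral_eq_integral_of_forall_compl_eq_zero]
    intro x hx
    rw [image_eq_zero_of_notMem_tsupport (fun hm => hx (h3 hm)), zero_smul])
  refine (Lp.eq_zero_iff_ae_eq_zero).2 ?_
  exact (ae_restrict_iff' measurableSet_Ioo).2 key

/-- The Sobolev space `H¹(0, ℓ)ⁿ`, as a subspace of `L²(0, ℓ)ⁿ`. -/
def sobolevH1 (ℓ : ℝ) (n : ℕ) : Submodule ℂ (IntervalL2 ℓ n) where
  carrier := {u | ∃ g, IsWeakDeriv u g}
  zero_mem' := ⟨0, IsWeakDeriv.zero⟩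
  add_mem' := by
    rintro u v ⟨g, hg⟩ ⟨h, hh⟩
    exact ⟨g + h, hg.add hh⟩
  smul_mem' := by
    rintro c u ⟨g, hg⟩
    exact ⟨c • g, hg.smul c⟩

/-- The weak derivative `u'` of `u ∈ H¹(0, ℓ)ⁿ`. -/
def weakDeriv {ℓ : ℝ} {n : ℕ} : sobolevH1 ℓ n →ₗ[ℂ] IntervalL2 ℓ n where
  toFun u := Classical.choose u.2
  map_add' u v := (Classical.choose_spec (u + v).2).unique
    ((Classical.choose_spec u.2).add (Classical.choose_spec v.2))
  map_smul' c u := (Classical.choose_spec (c • u).2).unique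
    ((Classical.choose_spec u.2).smul c)

theorem isWeakDeriv_weakDeriv {ℓ : ℝ} {n : ℕ} (u : sobolevH1 ℓ n) :
    IsWeakDeriv (u : IntervalL2 ℓ n) (weakDeriv u) :=
  Classical.choose_spec u.2

/-- `w`, restricted to `[0, ℓ]`, is the continuous representative of `u`; it is unique on `[0, ℓ]`
if `ℓ > 0`, and it exists for every `u ∈ H¹(0, ℓ)ⁿ`. -/
def IsContRep {ℓ : ℝ} {n : ℕ} (u : IntervalL2 ℓ n) (w : ℝ → EuclideanSpace ℂ (Fin n)) : Prop :=
  ContinuousOn w (Icc 0 ℓ) ∧ u =ᵐ[volume.restrict (Ioo (0 : ℝ) ℓ)] w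

/-! ### Hyperbolic systems on networks -/

/-- A first order hyperbolic system `u̇ₑ = Mₑ uₑ' + Nₑ uₑ` on a finite network with vertex set `V`
and edge set `E`; the edge `e` is the interval `(0, ℓₑ)`, oriented from its initial endpoint
`src e` (at `0`) to its terminal endpoint `tgt e` (at `ℓₑ`).  Square matrices carry the operator
norm induced by the Euclidean norm. -/
structure HyperbolicNetwork (V E : Type*) where
  src : E → V
  tgt : E → V
  len : E → ℝ
  len_pos : ∀ e, 0 < len e
  /-- number of unknowns on each edge -/
  k : E → ℕ
  k_pos : ∀ e, 0 < k e
  M : ∀ e, ℝ → Matrix (Fin (k e)) (Fin (k e)) ℂ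
  N : ∀ e, ℝ → Matrix (Fin (k e)) (Fin (k e)) ℂ
  Q : ∀ e, ℝ → Matrix (Fin (k e)) (Fin (k e)) ℂ
  M_lipschitz : ∀ e, ∃ C : ℝ≥0, LipschitzOnWith C (M e) (Icc 0 (len e))
  M_invertible : ∀ e, ∀ x ∈ Icc 0 (len e), IsUnit (M e x)
  N_bounded : ∀ e, MemLp (N e) ∞ (volume.restrict (Ioo 0 (len e)))
  Q_lipschitz : ∀ e, ∃ C : ℝ≥0, LipschitzOnWith C (Q e) (Icc 0 (len e))
  Q_hermitian : ∀ e, ∀ x ∈ Icc 0 (len e), (Q e x).IsHermitian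
  QM_hermitian : ∀ e, ∀ x ∈ Icc 0 (len e), (Q e x * M e x).IsHermitian
  Q_pos : ∀ e, ∃ q : ℝ, 0 < q ∧ ∀ x ∈ Icc 0 (len e), ∀ ξ : EuclideanSpace ℂ (Fin (k e)),
    q * ‖ξ‖ ^ 2 ≤ (inner ℂ ξ (matOp (Q e x) ξ)).re

namespace HyperbolicNetwork

variable {V E : Type*} (G : HyperbolicNetwork V E)

theorem M_bounded (e : E) : MemLp (G.M e) ∞ (volume.restrict (Ioo 0 (G.len e))) := by
  obtain ⟨C, hC⟩ := G.M_lipschitz e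
  have hc : ContinuousOn (G.M e) (Icc 0 (G.len e)) := hC.continuousOn
  obtain ⟨K, hK⟩ := isCompact_Icc.exists_bound_of_continuousOn hc
  refine memLp_top_of_bound
    ((hc.mono Ioo_subset_Icc_self).aestronglyMeasurable measurableSet_Ioo) K ?_
  exact (ae_restrict_iff' measurableSet_Ioo).2
    (Eventually.of_forall fun x hx => hK x (Ioo_subset_Icc_self hx))

/-- The space `𝐋²(𝒢) = ⨁ₑ L²(0, ℓₑ)^{kₑ}`, with its canonical norm. -/
abbrev L2 [Fintype E] : Type _ := PiLp 2 fun e : E => IntervalL2 (G.len e) (G.k e)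

/-- The inner product `(u, v) = ∑ₑ ∫₀^{ℓₑ} Qₑ uₑ · v̄ₑ dx` on `𝐋²(𝒢)`, linear in `u`; it induces a
norm equivalent to the canonical one. -/
def energyInner [Fintype E] (u v : G.L2) : ℂ :=
  ∑ e, ∫ x in Ioo 0 (G.len e), inner ℂ (v e x) (matOp (G.Q e x) (u e x))

/-- The endpoint `v` of the edge end `h = (e, s)`: the initial endpoint of `e` for `s = false`, the
terminal one for `s = true`. -/
def endVertex (h : E × Bool) : V := if h.2 then G.tgt h.1 else G.src h.1

/-- The coordinate in `[0, ℓₑ]` of an edge end. -/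
def endPos (h : E × Bool) : ℝ := if h.2 then G.len h.1 else 0

/-- The nonzero entry of the incidence matrix belonging to an edge end: `-1` at an initial endpoint,
`+1` at a terminal endpoint. -/
def endSign (h : E × Bool) : ℂ := if h.2 then 1 else -1

/-- The edge ends at the vertex `v`; if no edge is a loop, these are in bijection with the
edges `E_v` incident in `v`. -/
abbrev Ends (v : V) : Type _ := {h : E × Bool // G.endVertex h = v}

/-- The coordinates of `ℂ^{k_v}`, with `k_v` the sum of `kₑ` over the edge ends at `v`. -/
abbrev VertexIndex (v : V) : Type _ := Σ h : G.Ends v, Fin (G.k h.1.1)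

/-- `ℂ^{k_v}` with its Euclidean inner product. -/
abbrev VertexSpace (v : V) : Type _ := EuclideanSpace ℂ (G.VertexIndex v)

/-- The trace `γ_v(w) = (wₑ(v))ₑ ∈ ℂ^{k_v}`, for pointwise defined functions `wₑ` on the edges. -/
def trace (v : V) (w : ∀ e, ℝ → EuclideanSpace ℂ (Fin (G.k e))) : G.VertexSpace v :=
  WithLp.toLp 2 fun i => w i.1.1.1 (G.endPos i.1.1) i.2

/-- The block-diagonal matrix `T_v = diag (Qₑ(v) Mₑ(v) ι_{ve})`. -/
def T [DecidableEq E] [DecidableEq V] (v : V) :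
    Matrix (G.VertexIndex v) (G.VertexIndex v) ℂ :=
  Matrix.blockDiagonal' fun h : G.Ends v =>
    endSign h.1 • (G.Q h.1.1 (G.endPos h.1) * G.M h.1.1 (G.endPos h.1))

/-- The quadratic form `q_v(ξ) = T_v ξ · ξ̄` on `ℂ^{k_v}`. -/
def q [Fintype E] [DecidableEq E] [DecidableEq V] (v : V) (ξ : G.VertexSpace v) : ℂ :=
  inner ℂ ξ (matOp (G.T v) ξ)

/-- `Y` is totally isotropic for `q_v`: the restriction of `q_v` to `Y` vanishes. -/
def IsTotallyIsotropic [Fintype E] [DecidableEq E] [DecidableEq V] (v : V)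
    (Y : Submodule ℂ (G.VertexSpace v)) : Prop :=
  ∀ ξ ∈ Y, G.q v ξ = 0

/-- The subspace `T_v⁻¹ Y^⊥` of `ℂ^{k_v}`. -/
def dualBoundarySpace [Fintype E] [DecidableEq E] [DecidableEq V] (v : V)
    (Y : Submodule ℂ (G.VertexSpace v)) : Submodule ℂ (G.VertexSpace v) :=
  Yᗮ.map (matOp (G.T v)⁻¹ : G.VertexSpace v →ₗ[ℂ] G.VertexSpace v)

/-- The domain `{u ∈ ⨁ₑ H¹(0, ℓₑ)^{kₑ} : γ_v(u) ∈ Y_v for all v}`; the traces are those of the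
continuous representatives. -/
def domain [Fintype E] (Y : ∀ v, Submodule ℂ (G.VertexSpace v)) : Submodule ℂ G.L2 where
  carrier := {u | (∀ e, u e ∈ sobolevH1 (G.len e) (G.k e)) ∧
    ∃ w : ∀ e, ℝ → EuclideanSpace ℂ (Fin (G.k e)),
      (∀ e, IsContRep (u e) (w e)) ∧ ∀ v, G.trace v w ∈ Y v}
  zero_mem' := ⟨fun e => (sobolevH1 (G.len e) (G.k e)).zero_mem, fun _ _ => 0,
    fun _ => ⟨continuousOn_const, Lp.coeFn_zero _ _ _⟩, fun v => (Y v).zero_mem⟩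
  add_mem' := by
    rintro u u' ⟨h1, w, h2, h3⟩ ⟨h1', w', h2', h3'⟩
    refine ⟨fun e => (sobolevH1 (G.len e) (G.k e)).add_mem (h1 e) (h1' e),
      fun e x => w e x + w' e x, fun e => ⟨(h2 e).1.add (h2' e).1, ?_⟩,
      fun v => (Y v).add_mem (h3 v) (h3' v)⟩
    exact (Lp.coeFn_add (u e) (u' e)).trans ((h2 e).2.add (h2' e).2)
  smul_mem' := by
    rintro c u ⟨h1, w, h2, h3⟩
    refine ⟨fun e => (sobolevH1 (G.len e) (G.k e)).smul_mem c (h1 e),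
      fun e x => c • w e x, fun e => ⟨(h2 e).1.const_smul c, ?_⟩,
      fun v => (Y v).smul_mem c (h3 v)⟩
    exact (Lp.coeFn_smul c (u e)).trans ((h2 e).2.const_smul c)

/-- The operator `(𝒜 u)ₑ = Mₑ uₑ' + Nₑ uₑ` with domain `{u : γ_v(u) ∈ Y_v for all v}`. -/
def operator [Fintype E] (Y : ∀ v, Submodule ℂ (G.VertexSpace v)) : G.L2 →ₗ.[ℂ] G.L2 where
  domain := G.domain Y
  toFun :=
    { toFun := fun u => WithLp.toLp 2 fun e =>
        mulL2 (G.M e) (G.M_bounded e) (weakDeriv ⟨u.1 e, u.2.1 e⟩) +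
          mulL2 (G.N e) (G.N_bounded e) (u.1 e)
      map_add' := fun u v => by
        ext1 e
        have h : (⟨(u + v).1 e, (u + v).2.1 e⟩ : sobolevH1 (G.len e) (G.k e)) =
          ⟨u.1 e, u.2.1 e⟩ + ⟨v.1 e, v.2.1 e⟩ := rfl
        have h' : (u + v).1 e = u.1 e + v.1 e := rfl
        simp only [PiLp.add_apply]
        rw [h, h', map_add, map_add, map_add, add_add_add_comm]
      map_smul' := fun c u => by
        ext1 e
        have h : (⟨(c • u).1 e, (c • u).2.1 e⟩ : sobolevH1 (G.len e) (G.k e)) =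
          c • ⟨u.1 e, u.2.1 e⟩ := rfl
        have h' : (c • u).1 e = c • u.1 e := rfl
        simp only [PiLp.smul_apply, RingHom.id_apply]
        rw [h, h', map_smul, map_smul, map_smul, smul_add] }

/-- `Qₑ Nₑ + (Qₑ Nₑ)^* = (Qₑ Mₑ)'` almost everywhere on `(0, ℓₑ)`, for every edge. -/
def IsEnergyConserving : Prop :=
  ∀ e, ∀ᵐ x ∂(volume.restrict (Ioo 0 (G.len e))),
    HasDerivAt (fun y => G.Q e y * G.M e y)
      (G.Q e x * G.N e x + (G.Q e x * G.N e x)ᴴ) x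

end HyperbolicNetwork

end

/-!
The operator `𝒜` is skew-adjoint for the energy `(u, v) = ⟪v, Q u⟫`, up to a bounded operator, and
operators of this kind generate groups.

*Skew-symmetry.* Integration by parts on each edge, with the Hermitian matrix `Q M` as weight, gives
`(𝒜 u, v) + (u, 𝒜 v) = ∑ ⟪γ_v(v), T_v γ_v(u)⟫ + ⟪K v, u⟫`, the sum over the vertices, where the
multiplication by `K = Q N + (Q N)^* - (Q M)'` is bounded, as `Q M` is Lipschitz continuous. On the
domain of `𝒜` the boundary terms vanish, because `Y_v` is totally isotropic, also for the polarized
form (`inner_operator_add_inner_operator`).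

*Domain of the adjoint.* If `u ↦ ⟪x, Q 𝒜 u⟫` is represented by some `y ∈ 𝐋²(𝒢)`, test functions
supported inside an edge show that `Q M x`, hence `x`, is in `H¹`, and functions with prescribed
boundary values that `T_v γ_v(x) ∈ Y_v^⊥`. As `T_v⁻¹ Y_v^⊥` is totally isotropic, it is contained in
`Y_v`, so that `x` is in the domain of `𝒜` (`exists_domain_of_inner_operator`).

*Resolvents.* The square root `e` of the multiplication by `Q` is an isomorphism which turns the
energy into the inner product of a Hilbert space (`IsPositive.exists_inner_equiv`). An operator `A`
in a Hilbert space which is skew-adjoint up to a bounded operator `K` satisfies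
`(|r| - ‖K‖) ‖u‖ ≤ ‖(r - A) u‖` for real `r`, and `r - A` is onto for `|r| > ‖K‖`
(`IsQuasiSkewAdjoint.of_adjoint`). This is quasi-m-dissipativity of `A` and of `-A`.

*The group.* The symmetric Yosida approximations `A (1 - A² / s²)⁻¹` are bounded and commute, they
converge to `A` on its domain, and the real parts of their quadratic forms are bounded uniformly in
`s`, from above and below. Hence their exponentials converge, for positive and negative times at
once, to a group of growth `exp (k |t|)` whose derivative at `0` extends `A`
(`exists_group_of_tendsto`). The extension is not proper, since `r - A` is onto for some `r` above
the growth rate (`IsQuasiSkewAdjoint.mem_graph_of_tendsto`). If `K = 0`, then `k = 0`: the group is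
one of contractions, hence of isometries, for the energy.
-/

noncomputable section

/-! ### Quasi-skew-adjoint operators in a Hilbert space -/

section Abstract

variable {H : Type*} [NormedAddCommGroup H] [InnerProductSpace ℂ H]
  {D : Type*} [AddCommGroup D] [Module ℂ D]

local notation "⟪" x ", " y "⟫" => inner ℂ x y

theorem abs_re_inner_le {j A : D →ₗ[ℂ] H} {k : ℝ}
    (hb : ∀ u v, ‖⟪j v, A u⟫ + ⟪A v, j u⟫‖ ≤ k * ‖j v‖ * ‖j u‖) (u : D) :
    2 * |(⟪j u, A u⟫).re| ≤ k * ‖j u‖ ^ 2 := by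
  have h1 := (Complex.abs_re_le_norm _).trans (hb u u)
  have h2 : (⟪A u, j u⟫).re = (⟪j u, A u⟫).re := by
    rw [← inner_conj_symm, Complex.conj_re]
  rw [Complex.add_re, h2, ← two_mul, abs_mul, abs_two] at h1
  linarith

theorem mul_norm_sq_le_abs_re_inner {j A : D →ₗ[ℂ] H} {k : ℝ} (hk : 0 ≤ k)
    (hb : ∀ u v, ‖⟪j v, A u⟫ + ⟪A v, j u⟫‖ ≤ k * ‖j v‖ * ‖j u‖) (r : ℝ) (u : D) :
    (|r| - k) * ‖j u‖ ^ 2 ≤ |(⟪j u, (r : ℂ) • j u - A u⟫).re| := by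
  have h1 : (⟪j u, (r : ℂ) • j u - A u⟫).re = r * ‖j u‖ ^ 2 - (⟪j u, A u⟫).re := by
    rw [inner_sub_right, inner_smul_right, inner_self_eq_norm_sq_to_K, Complex.sub_re]
    congr 1
    rw [Complex.re_ofReal_mul]
    norm_cast
  have h2 := abs_re_inner_le hb u
  have h4 := abs_add_le (r * ‖j u‖ ^ 2 - (⟪j u, A u⟫).re) ((⟪j u, A u⟫).re)
  rw [sub_add_cancel, abs_mul, abs_of_nonneg (sq_nonneg ‖j u‖), ← h1] at h4
  nlinarith [mul_nonneg hk (sq_nonneg ‖j u‖)]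

/-- The operator `j u ↦ A u`, with domain the range of the injective map `j`, is skew-symmetric up
to a form of size `k`, and its resolvent is defined at every real number `r` with `|r| > k`. The
domain is an abstract space `D` rather than a subspace of `H`, so that operators can be transported
along isomorphisms by composition. -/
structure IsQuasiSkewAdjoint (j A : D →ₗ[ℂ] H) (k : ℝ) : Prop where
  inj : Function.Injective j
  nonneg : 0 ≤ k
  bound : ∀ u v, ‖⟪j v, A u⟫ + ⟪A v, j u⟫‖ ≤ k * ‖j v‖ * ‖j u‖
  surj : ∀ r : ℝ, k < |r| → ∀ f, ∃ u, (r : ℂ) • j u - A u = f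

namespace IsQuasiSkewAdjoint

variable {j A : D →ₗ[ℂ] H} {k : ℝ}

theorem neg (h : IsQuasiSkewAdjoint j A k) : IsQuasiSkewAdjoint j (-A) k where
  inj := h.inj
  nonneg := h.nonneg
  bound u v := by
    have := h.bound u v
    rwa [LinearMap.neg_apply, LinearMap.neg_apply, inner_neg_right, inner_neg_left, ← neg_add,
      norm_neg]
  surj r hr f := by
    obtain ⟨u, hu⟩ := h.surj (-r) (by rwa [abs_neg]) (-f)
    refine ⟨u, ?_⟩
    rw [← neg_inj, ← hu, LinearMap.neg_apply]
    push_cast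
    module

theorem norm_le (h : IsQuasiSkewAdjoint j A k) (r : ℝ) (u : D) :
    (|r| - k) * ‖j u‖ ≤ ‖(r : ℂ) • j u - A u‖ := by
  have h1 := mul_norm_sq_le_abs_re_inner h.nonneg h.bound r u
  have h3 : |(⟪j u, (r : ℂ) • j u - A u⟫).re| ≤ ‖j u‖ * ‖(r : ℂ) • j u - A u‖ :=
    (Complex.abs_re_le_norm _).trans (norm_inner_le_norm _ _)
  rcases (norm_nonneg (j u)).eq_or_lt with h0 | h0
  · rw [← h0, mul_zero]
    exact norm_nonneg _
  · refine le_of_mul_le_mul_left ?_ h0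
    linarith

theorem bijective (h : IsQuasiSkewAdjoint j A k) {r : ℝ} (hr : k < |r|) :
    Function.Bijective ((r : ℂ) • j - A) := by
  refine ⟨(injective_iff_map_eq_zero _).2 fun u hu => ?_, fun f => ?_⟩
  · have := h.norm_le r u
    rw [LinearMap.sub_apply, LinearMap.smul_apply] at hu
    rw [hu, norm_zero] at this
    have h2 : ‖j u‖ = 0 := by nlinarith [norm_nonneg (j u)]
    exact h.inj (by rw [norm_eq_zero.1 h2, map_zero])
  · exact h.surj r hr f

/-- The inverse of `r j - A`, with values in the abstract domain. -/
def lift (h : IsQuasiSkewAdjoint j A k) {r : ℝ} (hr : k < |r|) : H →ₗ[ℂ] D :=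
  (LinearEquiv.ofBijective ((r : ℂ) • j - A) (h.bijective hr)).symm.toLinearMap

theorem lift_spec (h : IsQuasiSkewAdjoint j A k) {r : ℝ} (hr : k < |r|) (f : H) :
    (r : ℂ) • j (h.lift hr f) - A (h.lift hr f) = f :=
  (LinearEquiv.ofBijective ((r : ℂ) • j - A) (h.bijective hr)).apply_symm_apply f

theorem lift_apply (h : IsQuasiSkewAdjoint j A k) {r : ℝ} (hr : k < |r|) (u : D) :
    h.lift hr ((r : ℂ) • j u - A u) = u :=
  (LinearEquiv.ofBijective ((r : ℂ) • j - A) (h.bijective hr)).symm_apply_apply u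

/-- The resolvent `(r - A)⁻¹`. -/
def res (h : IsQuasiSkewAdjoint j A k) {r : ℝ} (hr : k < |r|) : H →L[ℂ] H :=
  (j ∘ₗ h.lift hr).mkContinuous (|r| - k)⁻¹ fun f => by
    have := h.norm_le r (h.lift hr f)
    rw [h.lift_spec hr] at this
    rw [← div_eq_inv_mul, le_div_iff₀' (sub_pos.2 hr)]
    exact this

theorem res_apply (h : IsQuasiSkewAdjoint j A k) {r : ℝ} (hr : k < |r|) (f : H) :
    h.res hr f = j (h.lift hr f) := rfl

theorem map_lift (h : IsQuasiSkewAdjoint j A k) {r : ℝ} (hr : k < |r|) (f : H) :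
    A (h.lift hr f) = (r : ℂ) • h.res hr f - f := by
  exact (sub_sub_cancel _ _).symm.trans (congrArg _ (h.lift_spec hr f))

theorem norm_res_le (h : IsQuasiSkewAdjoint j A k) {r : ℝ} (hr : k < |r|) :
    ‖h.res hr‖ ≤ (|r| - k)⁻¹ :=
  LinearMap.mkContinuous_norm_le _ (inv_nonneg.2 (sub_pos.2 hr).le) _

theorem res_map (h : IsQuasiSkewAdjoint j A k) {r : ℝ} (hr : k < |r|) (u : D) :
    (r : ℂ) • h.res hr (j u) = j u + h.res hr (A u) := by
  have h1 : h.res hr ((r : ℂ) • j u - A u) = j u := by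
    rw [res_apply, lift_apply]
  rwa [map_sub, map_smul, sub_eq_iff_eq_add] at h1

theorem res_sub_res (h : IsQuasiSkewAdjoint j A k) {r s : ℝ} (hr : k < |r|) (hs : k < |s|) (f : H) :
    h.res hr f - h.res hs f = ((s : ℂ) - r) • h.res hr (h.res hs f) := by
  have h1 := h.res_map hr (h.lift hs f)
  rw [h.map_lift, ← res_apply, map_sub, map_smul] at h1
  rw [sub_smul, h1]
  abel

theorem commute_res (h : IsQuasiSkewAdjoint j A k) {r s : ℝ} (hr : k < |r|) (hs : k < |s|) :
    Commute (h.res hr) (h.res hs) := by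
  rcases eq_or_ne r s with rfl | hne
  · exact Commute.refl _
  ext f
  have h1 := h.res_sub_res hr hs f
  have h2 := h.res_sub_res hs hr f
  have h3 : ((s : ℂ) - r) ≠ 0 := by
    rw [sub_ne_zero]
    exact_mod_cast hne.symm
  refine smul_right_injective H h3 ?_
  change ((s : ℂ) - r) • h.res hr (h.res hs f) = ((s : ℂ) - r) • h.res hs (h.res hr f)
  rw [← h1, ← neg_sub (r : ℂ) s, neg_smul, ← h2, neg_sub]

/-- The symmetric Yosida approximation `A (1 - A² / s²)⁻¹` of `A`, in terms of resolvents. -/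
def yosida (h : IsQuasiSkewAdjoint j A k) {s : ℝ} (hs : k < |s|) : H →L[ℂ] H :=
  ((s : ℂ) ^ 2 / 2) • (h.res hs + h.res (r := -s) (by rwa [abs_neg]))

theorem commute_yosida (h : IsQuasiSkewAdjoint j A k) {r s : ℝ} (hr : k < |r|) (hs : k < |s|) :
    Commute (h.yosida hr) (h.yosida hs) :=
  (((h.commute_res _ _).add_right (h.commute_res _ _)).add_left
    ((h.commute_res _ _).add_right (h.commute_res _ _))).smul_left _ |>.smul_right _

/-- The real part of the form of a symmetric Yosida approximation is as small as that of `A`, up to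
a factor `2`: if `w = (1 - A² / s²)⁻¹ u` and `z = A w`, then `⟪u, z⟫ = ⟪w, A w⟫ - s⁻² ⟪A z, z⟫`,
where both forms on the right have a real part bounded by `k / 2` times the square of the norm, and
`‖w‖² + s⁻² ‖z‖² ≤ 2 ‖u‖²`. -/
theorem re_inner_yosida_le (h : IsQuasiSkewAdjoint j A k) {s : ℝ} (hs : k < |s|)
    (h2s : 2 * k ≤ s) (hs0 : 0 < s) (u : H) :
    |(⟪u, h.yosida hs u⟫).re| ≤ k * ‖u‖ ^ 2 := by
  -- `w = j d₂` and `z = j d₃`, with `A d₂ = z`; moreover `p = A d₃ = A² w`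
  have hs' : k < |-s| := by rwa [abs_neg]
  have hsC : (s : ℂ) ≠ 0 := by exact_mod_cast hs0.ne'
  obtain ⟨d₂, hd₂⟩ : ∃ d, d = -((s : ℂ) ^ 2) • h.lift hs (h.res hs' u) := ⟨_, rfl⟩
  obtain ⟨d₃, hd₃⟩ : ∃ d, d = ((s : ℂ) ^ 2 / 2) • (h.lift hs u + h.lift hs' u) := ⟨_, rfl⟩
  have hz : h.yosida hs u = j d₃ := by
    rw [hd₃, map_smul, map_add]
    rfl
  have hsub := h.res_sub_res hs hs' u
  have hAd₂ : A d₂ = j d₃ := by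
    have e3 : h.res hs (h.res hs' u) = -(2 * (s : ℂ))⁻¹ • (h.res hs u - h.res hs' u) := by
      rw [hsub, smul_smul]
      push_cast
      rw [show -(2 * (s : ℂ))⁻¹ * (-s - s) = 1 by field_simp; ring, one_smul]
    rw [hd₂, map_smul, h.map_lift, e3, ← hz, yosida]
    simp only [_root_.smul_apply, _root_.add_apply]
    match_scalars <;> field_simp
    norm_num
  have hu : u = j d₂ - ((s : ℂ) ^ 2)⁻¹ • A d₃ := by
    have e3 : j d₂ = ((s : ℂ) / 2) • (h.res hs u - h.res hs' u) := by
      rw [hd₂, map_smul, ← res_apply, hsub, smul_smul]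
      push_cast
      match_scalars
      ring
    rw [e3, hd₃, map_smul, map_add, h.map_lift, h.map_lift]
    push_cast
    match_scalars <;> field_simp <;> ring
  have b1 := abs_re_inner_le h.bound d₂
  have b2 := abs_re_inner_le h.bound d₃
  have b3 := (Complex.abs_re_le_norm _).trans (h.bound d₃ d₂)
  rw [hAd₂] at b1 b3
  rw [Complex.add_re, inner_self_eq_norm_sq_to_K] at b3
  rw [hz]
  set w := j d₂
  set z := j d₃
  set p := A d₃
  have c1 : (⟪u, z⟫).re = (⟪w, z⟫).re - (s ^ 2)⁻¹ * (⟪z, p⟫).re := by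
    rw [hu, inner_sub_left, inner_smul_left, Complex.sub_re, ← inner_conj_symm p z]
    congr 1
    rw [← Complex.ofReal_pow, ← Complex.ofReal_inv, Complex.conj_ofReal, Complex.re_ofReal_mul,
      Complex.conj_re]
  have c2 : ‖w‖ ^ 2 - 2 * (s ^ 2)⁻¹ * (⟪w, p⟫).re ≤ ‖u‖ ^ 2 := by
    have := norm_sub_sq (𝕜 := ℂ) w (((s : ℂ) ^ 2)⁻¹ • p)
    rw [← hu, inner_smul_right] at this
    rw [this, ← Complex.ofReal_pow, ← Complex.ofReal_inv]
    change _ ≤ _ - 2 * (((s ^ 2)⁻¹ : ℝ) * ⟪w, p⟫ : ℂ).re + _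
    rw [Complex.re_ofReal_mul]
    nlinarith [sq_nonneg ‖(((s ^ 2)⁻¹ : ℝ) : ℂ) • p‖]
  have c3 : ((‖z‖ : ℂ) ^ 2).re = ‖z‖ ^ 2 := by norm_cast
  have b3' : (⟪w, p⟫).re ≤ k * ‖w‖ * ‖z‖ - ‖z‖ ^ 2 := by
    have := (le_abs_self _).trans b3
    change (⟪w, p⟫).re + ((‖z‖ : ℂ) ^ 2).re ≤ _ at this
    rw [c3] at this
    linarith
  -- in the variable `t = ‖z‖ / s`, all estimates are free of `s`
  obtain ⟨t, ht⟩ : ∃ t, t = ‖z‖ / s := ⟨_, rfl⟩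
  have hzt : ‖z‖ = t * s := by rw [ht]; field_simp
  have hi : (s ^ 2)⁻¹ * s ^ 2 = 1 := by field_simp
  have ht0 : 0 ≤ t := by rw [ht]; positivity
  have d1 : 2 * (s ^ 2)⁻¹ * (⟪w, p⟫).re ≤ ‖w‖ * t - 2 * t ^ 2 := by
    have : 2 * (s ^ 2)⁻¹ * (⟪w, p⟫).re ≤ 2 * (s ^ 2)⁻¹ * (k * ‖w‖ * ‖z‖ - ‖z‖ ^ 2) :=
      mul_le_mul_of_nonneg_left b3' (by positivity)
    refine this.trans ?_
    rw [hzt]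
    have e : 2 * (s ^ 2)⁻¹ * (k * ‖w‖ * (t * s) - (t * s) ^ 2) =
        (2 * k / s) * (‖w‖ * t) - 2 * t ^ 2 := by field_simp
    rw [e]
    have : 2 * k / s ≤ 1 := (div_le_one hs0).2 h2s
    nlinarith [mul_nonneg (norm_nonneg w) ht0]
  have d2 : ‖w‖ ^ 2 + t ^ 2 ≤ 2 * ‖u‖ ^ 2 := by
    nlinarith [sq_nonneg (‖w‖ - t), sq_nonneg t]
  have d3 : 2 * |(⟪u, z⟫).re| ≤ k * (‖w‖ ^ 2 + t ^ 2) := by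
    rw [c1]
    have e1 := abs_sub (⟪w, z⟫).re ((s ^ 2)⁻¹ * (⟪z, p⟫).re)
    rw [abs_mul, abs_of_pos (show 0 < (s ^ 2)⁻¹ by positivity)] at e1
    have e2 : (s ^ 2)⁻¹ * (2 * |(⟪z, p⟫).re|) ≤ (s ^ 2)⁻¹ * (k * ‖z‖ ^ 2) :=
      mul_le_mul_of_nonneg_left b2 (by positivity)
    rw [hzt, mul_pow, show (s ^ 2)⁻¹ * (k * (t ^ 2 * s ^ 2)) = k * t ^ 2 by field_simp] at e2
    linarith
  nlinarith [mul_le_mul_of_nonneg_left d2 h.nonneg]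

end IsQuasiSkewAdjoint

end Abstract

/-! ### Groups as limits of exponentials -/

section Exponential

variable {H : Type*} [NormedAddCommGroup H] [InnerProductSpace ℂ H] [CompleteSpace H]

local notation "⟪" x ", " y "⟫" => inner ℂ x y

theorem hasDerivAt_exp_smul_apply (a : H →L[ℂ] H) (x : H) (t : ℝ) :
    HasDerivAt (fun s : ℝ => NormedSpace.exp (s • a) x) (NormedSpace.exp (t • a) (a x)) t :=
  ((ContinuousLinearMap.apply ℂ H x).restrictScalars ℝ).hasFDerivAt.comp_hasDerivAt t
    (hasDerivAt_exp_smul_const (𝕂 := ℝ) a t)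

theorem hasDerivAt_exp_smul_apply' (a : H →L[ℂ] H) (x : H) (t : ℝ) :
    HasDerivAt (fun s : ℝ => NormedSpace.exp (s • a) x) (a (NormedSpace.exp (t • a) x)) t :=
  ((ContinuousLinearMap.apply ℂ H x).restrictScalars ℝ).hasFDerivAt.comp_hasDerivAt t
    (hasDerivAt_exp_smul_const' (𝕂 := ℝ) a t)

/-- The derivative of `‖exp (t a) x‖²` is at most `2 k ‖exp (t a) x‖²`. -/
theorem norm_exp_smul_le_of_nonneg {a : H →L[ℂ] H} {k : ℝ}
    (ha : ∀ u, |(⟪u, a u⟫).re| ≤ k * ‖u‖ ^ 2) {t : ℝ} (ht : 0 ≤ t) (x : H) :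
    ‖NormedSpace.exp (t • a) x‖ ≤ Real.exp (k * t) * ‖x‖ := by
  set y : ℝ → H := fun s => NormedSpace.exp (s • a) x with hy
  have hd : ∀ s, HasDerivAt (fun s => Real.exp (-(2 * k) * s) * ‖y s‖ ^ 2)
      (Real.exp (-(2 * k) * s) * (-(2 * k)) * ‖y s‖ ^ 2 +
        Real.exp (-(2 * k) * s) * (2 * (⟪y s, a (y s)⟫).re)) s := fun s => by
    have h1 : HasDerivAt (fun s => Real.exp (-(2 * k) * s))
        (Real.exp (-(2 * k) * s) * (-(2 * k))) s := by
      simpa using ((hasDerivAt_id s).const_mul (-(2 * k))).exp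
    have h2 : HasDerivAt (fun s => ‖y s‖ ^ 2) (2 * (⟪y s, a (y s)⟫).re) s :=
      letI := InnerProductSpace.complexToReal (G := H)
      (hasDerivAt_exp_smul_apply' a x s).norm_sq
    exact h1.mul h2
  have hanti : Antitone (fun s => Real.exp (-(2 * k) * s) * ‖y s‖ ^ 2) :=
    antitone_of_hasDerivAt_nonpos hd fun s => by
      have h1 := (le_abs_self _).trans (ha (y s))
      have h2 := Real.exp_pos (-(2 * k) * s)
      simp only [Pi.zero_apply]
      nlinarith
  have h0 := hanti ht
  have hy0 : y 0 = x := by simp [hy]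
  simp only [mul_zero, Real.exp_zero, one_mul, hy0] at h0
  refine le_of_sq_le_sq ?_ (by positivity)
  calc ‖y t‖ ^ 2 = Real.exp (k * t) ^ 2 * (Real.exp (-(2 * k) * t) * ‖y t‖ ^ 2) := by
        rw [← mul_assoc, ← Real.exp_nat_mul, ← Real.exp_add]
        ring_nf
        simp
    _ ≤ Real.exp (k * t) ^ 2 * ‖x‖ ^ 2 := by gcongr
    _ = _ := by ring

theorem norm_exp_smul_le {a : H →L[ℂ] H} {k : ℝ}
    (ha : ∀ u, |(⟪u, a u⟫).re| ≤ k * ‖u‖ ^ 2) (t : ℝ) (x : H) :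
    ‖NormedSpace.exp (t • a) x‖ ≤ Real.exp (k * |t|) * ‖x‖ := by
  rcases le_total 0 t with ht | ht
  · rw [abs_of_nonneg ht]
    exact norm_exp_smul_le_of_nonneg ha ht x
  · rw [abs_of_nonpos ht, ← neg_smul_neg t a]
    refine norm_exp_smul_le_of_nonneg (fun u => ?_) (neg_nonneg.2 ht) x
    rw [_root_.neg_apply, inner_neg_right, Complex.neg_re, abs_neg]
    exact ha u

theorem norm_exp_smul_sub_le_of_nonneg {c : H →L[ℂ] H} {k : ℝ} (hk : 0 ≤ k)
    (hc : ∀ u, |(⟪u, c u⟫).re| ≤ k * ‖u‖ ^ 2) {t : ℝ} (ht : 0 ≤ t) (x : H) :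
    ‖NormedSpace.exp (t • c) x - x‖ ≤ Real.exp (k * t) * ‖c x‖ * t := by
  have h := norm_image_sub_le_of_norm_deriv_le_segment' (a := 0) (b := t)
    (C := Real.exp (k * t) * ‖c x‖)
    (fun s _ => (hasDerivAt_exp_smul_apply c x s).hasDerivWithinAt) (fun s hs => ?_) t
    (right_mem_Icc.2 ht)
  · simpa using h
  · refine (norm_exp_smul_le_of_nonneg hc hs.1 (c x)).trans ?_
    gcongr
    exact hs.2.le

theorem norm_exp_smul_sub_le {c : H →L[ℂ] H} {k : ℝ} (hk : 0 ≤ k)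
    (hc : ∀ u, |(⟪u, c u⟫).re| ≤ k * ‖u‖ ^ 2) (t : ℝ) (x : H) :
    ‖NormedSpace.exp (t • c) x - x‖ ≤ Real.exp (k * |t|) * ‖c x‖ * |t| := by
  rcases le_total 0 t with ht | ht
  · rw [abs_of_nonneg ht]
    exact norm_exp_smul_sub_le_of_nonneg hk hc ht x
  · rw [abs_of_nonpos ht, ← neg_smul_neg t c, ← norm_neg (c x)]
    refine norm_exp_smul_sub_le_of_nonneg hk (fun u => ?_) (neg_nonneg.2 ht) x
    rw [_root_.neg_apply, inner_neg_right, Complex.neg_re, abs_neg]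
    exact hc u

theorem exp_add_smul (a : H →L[ℂ] H) (s t : ℝ) :
    NormedSpace.exp ((s + t) • a) = NormedSpace.exp (s • a) * NormedSpace.exp (t • a) := by
  let := NormedAlgebra.restrictScalars ℚ ℂ (H →L[ℂ] H)
  rw [add_smul]
  exact NormedSpace.exp_add_of_commute (((Commute.refl a).smul_left s).smul_right t)

/-- Since `a` and `b` commute, `exp (t a) - exp (t b) = exp (t b) (exp (t (a - b)) - 1)`, so that
the difference is controlled by `a x - b x`; the constant `3 k` is `k` for `b` plus `2 k` for `a -
b`. -/
theorem norm_exp_smul_sub_exp_smul_le {a b : H →L[ℂ] H} (hab : Commute a b) {k : ℝ} (hk : 0 ≤ k)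
    (ha : ∀ u, |(⟪u, a u⟫).re| ≤ k * ‖u‖ ^ 2) (hb : ∀ u, |(⟪u, b u⟫).re| ≤ k * ‖u‖ ^ 2)
    (t : ℝ) (x : H) :
    ‖NormedSpace.exp (t • a) x - NormedSpace.exp (t • b) x‖ ≤
      Real.exp (3 * k * |t|) * |t| * ‖a x - b x‖ := by
  have h1 : NormedSpace.exp (t • a) =
      NormedSpace.exp (t • b) * NormedSpace.exp (t • (a - b)) := by
    let := NormedAlgebra.restrictScalars ℚ ℂ (H →L[ℂ] H)
    have hc : Commute (t • b) (t • (a - b)) :=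
      ((hab.symm.sub_right (Commute.refl b)).smul_left t).smul_right t
    rw [← NormedSpace.exp_add_of_commute hc, ← smul_add, add_sub_cancel]
  have hc : ∀ u, |(⟪u, (a - b) u⟫).re| ≤ 2 * k * ‖u‖ ^ 2 := fun u => by
    rw [_root_.sub_apply, inner_sub_right, Complex.sub_re]
    have := abs_sub (⟪u, a u⟫).re (⟪u, b u⟫).re
    linarith [ha u, hb u]
  have h2 : NormedSpace.exp (t • a) x - NormedSpace.exp (t • b) x =
      NormedSpace.exp (t • b) (NormedSpace.exp (t • (a - b)) x - x) := by
    rw [h1, map_sub]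
    rfl
  rw [h2]
  refine (norm_exp_smul_le hb t _).trans ?_
  refine (mul_le_mul_of_nonneg_left (norm_exp_smul_sub_le (by positivity) hc t x)
    (Real.exp_pos _).le).trans (le_of_eq ?_)
  rw [show 3 * k * |t| = k * |t| + 2 * k * |t| by ring, Real.exp_add, _root_.sub_apply]
  ring

/-- Let `a n` be commuting bounded operators which are skew-symmetric up to a form of size `k`. If
`a n x` converges for all `x` in a dense set, then `exp (t (a n))` converges strongly, uniformly for
bounded `t`, to a strongly continuous group, whose generator extends the limit of `a n`. -/
theorem exists_group_of_tendsto {ι : Type*} {j A : ι → H} (hj : DenseRange j)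
    {a : ℕ → H →L[ℂ] H} (hcomm : ∀ m n, Commute (a m) (a n)) {k : ℝ} (hk : 0 ≤ k)
    (ha : ∀ n u, |(⟪u, a n u⟫).re| ≤ k * ‖u‖ ^ 2)
    (hlim : ∀ d, Tendsto (fun n => a n (j d)) atTop (𝓝 (A d))) :
    ∃ S : C0Group H, (∀ t x, ‖S.op t x‖ ≤ Real.exp (k * |t|) * ‖x‖) ∧
      ∀ d, HasDerivAt (fun t => S.op t (j d)) (A d) 0 := by
  set E : ℕ → ℝ → H →L[ℂ] H := fun n t => NormedSpace.exp (t • a n) with hE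
  have hEb : ∀ n t x, ‖E n t x‖ ≤ Real.exp (k * |t|) * ‖x‖ := fun n t x =>
    norm_exp_smul_le (ha n) t x
  have hcauchy : ∀ (R : ℝ) (x : H), UniformCauchySeqOn (fun n t => E n t x) atTop
      (Metric.ball 0 R) := by
    intro R x
    rw [Metric.uniformCauchySeqOn_iff]
    intro ε hε
    rcases le_or_gt R 0 with hR | hR
    · exact ⟨0, fun _ _ _ _ t ht => by simp [Metric.ball_eq_empty.2 hR] at ht⟩
    set C := Real.exp (k * R) with hC
    set C' := Real.exp (3 * k * R) * R with hC'
    have hCpos : 0 < C := Real.exp_pos _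
    have hC'pos : 0 < C' := mul_pos (Real.exp_pos _) hR
    obtain ⟨d, hd⟩ := hj.exists_dist_lt x (show 0 < ε / (4 * C) by positivity)
    obtain ⟨N, hN⟩ := Metric.cauchySeq_iff.1 (hlim d).cauchySeq (ε / (4 * C')) (by positivity)
    refine ⟨N, fun m hm n hn t ht => ?_⟩
    have htR : |t| ≤ R := by simpa using (mem_ball_zero_iff.1 ht).le
    have e1 : ∀ n, ‖E n t (x - j d)‖ ≤ ε / 4 := fun n => by
      refine (hEb n t _).trans ?_
      rw [dist_eq_norm] at hd
      calc Real.exp (k * |t|) * ‖x - j d‖ ≤ C * (ε / (4 * C)) := by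
            rw [hC]
            gcongr
        _ = ε / 4 := by field_simp
    have e2 : ‖E m t (j d) - E n t (j d)‖ < ε / 4 := by
      refine (norm_exp_smul_sub_exp_smul_le (hcomm m n) hk (ha m) (ha n) t (j d)).trans_lt ?_
      have h1 := hN m hm n hn
      rw [dist_eq_norm] at h1
      calc Real.exp (3 * k * |t|) * |t| * ‖a m (j d) - a n (j d)‖
          ≤ C' * ‖a m (j d) - a n (j d)‖ := by rw [hC']; gcongr
        _ < C' * (ε / (4 * C')) := by gcongr
        _ = ε / 4 := by field_simp
    have e3 : E m t x - E n t x =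
        E m t (x - j d) - E n t (x - j d) + (E m t (j d) - E n t (j d)) := by
      rw [map_sub, map_sub]
      abel
    rw [dist_eq_norm, e3]
    have := norm_add_le (E m t (x - j d) - E n t (x - j d)) (E m t (j d) - E n t (j d))
    have := norm_sub_le (E m t (x - j d)) (E n t (x - j d))
    linarith [e1 m, e1 n]
  have hpt : ∀ t x, ∃ y, Tendsto (fun n => E n t x) atTop (𝓝 y) := fun t x =>
    cauchySeq_tendsto_of_complete
      ((hcauchy (|t| + 1) x).cauchySeq (by simp))
  choose U hU using hpt
  have hUb : ∀ t x, ‖U t x‖ ≤ Real.exp (k * |t|) * ‖x‖ := fun t x =>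
    le_of_tendsto (hU t x).norm (Eventually.of_forall fun n => hEb n t x)
  have hunif : ∀ (R : ℝ) (x : H), TendstoUniformlyOn (fun n t => E n t x) (fun t => U t x) atTop
      (Metric.ball 0 R) := fun R x =>
    (hcauchy R x).tendstoUniformlyOn_of_tendsto fun t _ => hU t x
  let UL : ℝ → H →L[ℂ] H := fun t => LinearMap.mkContinuous
    { toFun := U t
      map_add' := fun x y => tendsto_nhds_unique (hU t (x + y)) (by
        simpa using (hU t x).add (hU t y))
      map_smul' := fun c x => tendsto_nhds_unique (hU t (c • x)) (by
        simpa using (hU t x).const_smul c) } (Real.exp (k * |t|)) (hUb t)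
  have hUL : ∀ t x, UL t x = U t x := fun _ _ => rfl
  have hcont : ∀ x, Continuous fun t => U t x := by
    intro x
    rw [continuous_iff_continuousAt]
    intro t
    have h1 : ContinuousOn (fun t => U t x) (Metric.ball 0 (|t| + 1)) :=
      (hunif _ x).continuousOn (Frequently.of_forall fun n => Continuous.continuousOn
        (continuous_iff_continuousAt.2 fun s => (hasDerivAt_exp_smul_apply (a n) x s).continuousAt))
    exact h1.continuousAt (Metric.isOpen_ball.mem_nhds (by simp))
  refine ⟨⟨UL, ?_, ?_, hcont⟩, hUb, fun d => ?_⟩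
  · ext x
    refine tendsto_nhds_unique (hU 0 x) ?_
    simp [hE]
  · intro s t
    ext x
    refine tendsto_nhds_unique (hU (s + t) x) ?_
    have h1 : ∀ n, E n (s + t) x = E n s (E n t x - U t x) + E n s (U t x) := fun n => by
      rw [← map_add, sub_add_cancel, hE]
      simp only [exp_add_smul]
      rfl
    have h2 : Tendsto (fun n => E n s (E n t x - U t x)) atTop (𝓝 0) := by
      refine squeeze_zero_norm (fun n => hEb n s _) ?_
      have := (tendsto_iff_norm_sub_tendsto_zero.1 (hU t x)).const_mul (Real.exp (k * |s|))
      simpa using this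
    simp only [h1]
    have := h2.add (hU s (U t x))
    rwa [zero_add] at this
  · have h1 : TendstoUniformlyOn (fun n t => E n t (a n (j d))) (fun t => U t (A d)) atTop
        (Metric.ball 0 1) := by
      rw [Metric.tendstoUniformlyOn_iff]
      intro ε hε
      have hCpos := Real.exp_pos k
      have h2 := Metric.tendstoUniformlyOn_iff.1 (hunif 1 (A d)) (ε / 2) (by positivity)
      have h3 := Metric.tendsto_nhds.1 (hlim d) (ε / 2 / Real.exp k) (by positivity)
      filter_upwards [h2, h3] with n hn2 hn3 t ht
      have ht1 : |t| ≤ 1 := by simpa using (mem_ball_zero_iff.1 ht).le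
      have e1 : dist (E n t (A d)) (E n t (a n (j d))) < ε / 2 := by
        rw [dist_eq_norm, ← map_sub]
        rw [dist_comm, dist_eq_norm] at hn3
        calc ‖E n t (A d - a n (j d))‖ ≤ Real.exp (k * |t|) * ‖A d - a n (j d)‖ := hEb _ _ _
          _ ≤ Real.exp (k * 1) * ‖A d - a n (j d)‖ := by gcongr
          _ < Real.exp k * (ε / 2 / Real.exp k) := by rw [mul_one]; gcongr
          _ = ε / 2 := by field_simp
      have := dist_triangle (U t (A d)) (E n t (A d)) (E n t (a n (j d)))
      linarith [hn2 t ht]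
    have h2 := hasDerivAt_of_tendstoUniformlyOn (x := (0 : ℝ)) Metric.isOpen_ball h1
      (Eventually.of_forall fun n t _ => hasDerivAt_exp_smul_apply (a n) (j d) t)
      (fun t _ => hU t (j d)) (by simp)
    have h3 : U 0 (A d) = A d := tendsto_nhds_unique (hU 0 (A d)) (by simp [hE])
    rwa [h3] at h2

end Exponential

/-! ### Generation of groups by quasi-skew-adjoint operators -/

section Generation

variable {H : Type*} [NormedAddCommGroup H] [InnerProductSpace ℂ H]
  {D : Type*} [AddCommGroup D] [Module ℂ D] {j A : D →ₗ[ℂ] H} {k : ℝ}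

local notation "⟪" x ", " y "⟫" => inner ℂ x y

namespace IsQuasiSkewAdjoint

/-- An operator which equals minus its adjoint, up to a bounded operator `K`, is
quasi-skew-adjoint: `r - A` has closed range, because `A` is closed as an adjoint, and an element
orthogonal to the range belongs to the domain, hence vanishes. -/
theorem of_adjoint [CompleteSpace H] {K : H →L[ℂ] H} (hinj : Function.Injective j)
    (h1 : ∀ u v, ⟪j v, A u⟫ + ⟪A v, j u⟫ = ⟪K (j v), j u⟫)
    (h2 : ∀ x y, (∀ u, ⟪x, A u⟫ = ⟪y, j u⟫) → ∃ v, j v = x ∧ A v = K x - y) :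
    IsQuasiSkewAdjoint j A ‖K‖ := by
  have hb : ∀ u v, ‖⟪j v, A u⟫ + ⟪A v, j u⟫‖ ≤ ‖K‖ * ‖j v‖ * ‖j u‖ := fun u v => by
    rw [h1]
    exact (norm_inner_le_norm _ _).trans
      (mul_le_mul_of_nonneg_right (K.le_opNorm _) (norm_nonneg _))
  refine ⟨hinj, norm_nonneg K, hb, fun r hr => ?_⟩
  have hpos := sub_pos.2 hr
  set L : D →ₗ[ℂ] H := (r : ℂ) • j - A with hL
  have hLu : ∀ u, L u = (r : ℂ) • j u - A u := fun _ => rfl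
  have hlow : ∀ u, (|r| - ‖K‖) * ‖j u‖ ^ 2 ≤ |(⟪j u, L u⟫).re| := fun u =>
    mul_norm_sq_le_abs_re_inner (norm_nonneg K) hb r u
  have hnorm : ∀ u, (|r| - ‖K‖) * ‖j u‖ ≤ ‖L u‖ := fun u => by
    have h3 : |(⟪j u, L u⟫).re| ≤ ‖j u‖ * ‖L u‖ :=
      (Complex.abs_re_le_norm _).trans (norm_inner_le_norm _ _)
    rcases (norm_nonneg (j u)).eq_or_lt with h0 | h0
    · rw [← h0, mul_zero]
      exact norm_nonneg _
    · refine le_of_mul_le_mul_left ?_ h0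
      linarith [hlow u]
  have hclosed : IsClosed (LinearMap.range L : Set H) := by
    refine IsSeqClosed.isClosed fun f f₀ hf hlim => ?_
    choose u hu using hf
    have hc : CauchySeq fun n => j (u n) := by
      have hc' := hlim.cauchySeq
      rw [Metric.cauchySeq_iff] at hc' ⊢
      intro ε hε
      obtain ⟨N, hN⟩ := hc' ((|r| - ‖K‖) * ε) (mul_pos hpos hε)
      refine ⟨N, fun m hm n hn => ?_⟩
      have h3 := hnorm (u m - u n)
      have h4 := hN m hm n hn
      rw [dist_eq_norm, ← hu m, ← hu n, ← map_sub] at h4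
      rw [dist_eq_norm, ← map_sub]
      exact lt_of_mul_lt_mul_left (h3.trans_lt h4) hpos.le
    obtain ⟨x, hx⟩ := cauchySeq_tendsto_of_complete hc
    obtain ⟨v, hv, hAv⟩ := h2 x (K x - ((r : ℂ) • x - f₀)) fun u' => by
      have e1 : ∀ n, ⟪j (u n), A u'⟫ =
          ⟪K (j (u n)) - ((r : ℂ) • j (u n) - f n), j u'⟫ := fun n => by
        rw [← hu n, hLu, sub_sub_cancel, inner_sub_left, ← h1, add_sub_cancel_right]
      have l1 : Tendsto (fun n => ⟪j (u n), A u'⟫) atTop (𝓝 ⟪x, A u'⟫) :=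
        hx.inner tendsto_const_nhds
      have l2 : Tendsto (fun n => ⟪K (j (u n)) - ((r : ℂ) • j (u n) - f n), j u'⟫) atTop
          (𝓝 ⟪K x - ((r : ℂ) • x - f₀), j u'⟫) :=
        (((K.continuous.tendsto x).comp hx).sub ((hx.const_smul (r : ℂ)).sub hlim)).inner
          tendsto_const_nhds
      exact tendsto_nhds_unique l1 (by simpa only [e1] using l2)
    refine ⟨v, ?_⟩
    rw [hLu, hv, hAv]
    abel
  have horth : (LinearMap.range L)ᗮ = ⊥ := by
    rw [Submodule.eq_bot_iff]
    intro x hx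
    have hx' : ∀ u, ⟪x, L u⟫ = 0 := fun u =>
      Submodule.inner_left_of_mem_orthogonal (LinearMap.mem_range_self L u) hx
    obtain ⟨v, hv, -⟩ := h2 x ((r : ℂ) • x) fun u => by
      have := hx' u
      rw [hLu, inner_sub_right, inner_smul_right, sub_eq_zero] at this
      rw [← this, inner_smul_left, Complex.conj_ofReal]
    have h3 := hlow v
    rw [hv, hx' v, Complex.zero_re, abs_zero] at h3
    have h4 : ‖x‖ ^ 2 = 0 := by nlinarith [sq_nonneg ‖x‖]
    exact norm_eq_zero.1 (pow_eq_zero_iff two_ne_zero |>.1 h4)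
  have htop : LinearMap.range L = ⊤ := by
    rw [← hclosed.submodule_topologicalClosure_eq]
    exact (Submodule.topologicalClosure_eq_top_iff).2 horth
  exact LinearMap.range_eq_top.1 htop

/-- The domain is dense, since `r - A` is surjective and coercive for large `r`. -/
theorem denseRange [CompleteSpace H] (h : IsQuasiSkewAdjoint j A k) : DenseRange j := by
  have horth : (LinearMap.range j)ᗮ = ⊥ := by
    rw [Submodule.eq_bot_iff]
    intro x hx
    have hr : k < |k + 1| := (lt_add_one k).trans_le (le_abs_self _)
    obtain ⟨u, hu⟩ := h.surj _ hr x
    have h3 := mul_norm_sq_le_abs_re_inner h.nonneg h.bound (k + 1) u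
    rw [hu, Submodule.inner_right_of_mem_orthogonal (LinearMap.mem_range_self j u) hx,
      Complex.zero_re, abs_zero] at h3
    have h4 : ‖j u‖ ^ 2 = 0 := by nlinarith [sq_nonneg ‖j u‖]
    have h5 : u = 0 := h.inj (by
      rw [map_zero, norm_eq_zero.1 (pow_eq_zero_iff two_ne_zero |>.1 h4)])
    rw [← hu, h5, map_zero, map_zero, smul_zero, sub_zero]
  exact Submodule.dense_iff_topologicalClosure_eq_top.2
    ((Submodule.topologicalClosure_eq_top_iff).2 horth)

theorem tendsto_smul_res [CompleteSpace H] (h : IsQuasiSkewAdjoint j A k) {r : ℕ → ℝ}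
    (hr : ∀ n, k < |r n|) (hr' : Tendsto (fun n => |r n|) atTop atTop) (y : H) :
    Tendsto (fun n => (r n : ℂ) • h.res (hr n) y) atTop (𝓝 y) := by
  rw [Metric.tendsto_nhds]
  intro ε hε
  obtain ⟨d, hd⟩ := h.denseRange.exists_dist_lt y (show 0 < ε / 6 by positivity)
  have hlim : Tendsto (fun n => (|r n| - k)⁻¹ * ‖A d‖) atTop (𝓝 0) := by
    have := (tendsto_inv_atTop_zero.comp (tendsto_atTop_add_const_right atTop (-k) hr')).mul_const
      ‖A d‖
    rwa [zero_mul] at this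
  filter_upwards [hlim.eventually_lt_const (show (0 : ℝ) < ε / 2 by positivity),
    hr'.eventually_ge_atTop (2 * k)] with n hn1 hn2
  have hpos := sub_pos.2 (hr n)
  have e1 : (r n : ℂ) • h.res (hr n) y - y =
      (r n : ℂ) • h.res (hr n) (y - j d) - (y - j d) + h.res (hr n) (A d) := by
    rw [map_sub, smul_sub, h.res_map]
    abel
  have e2 : ‖(r n : ℂ) • h.res (hr n) (y - j d)‖ ≤ 2 * ‖y - j d‖ := by
    rw [norm_smul, Complex.norm_real, Real.norm_eq_abs]
    calc |r n| * ‖h.res (hr n) (y - j d)‖ ≤ |r n| * ((|r n| - k)⁻¹ * ‖y - j d‖) := by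
          gcongr
          exact (h.res (hr n)).le_of_opNorm_le (h.norm_res_le (hr n)) _
      _ = |r n| / (|r n| - k) * ‖y - j d‖ := by ring
      _ ≤ 2 * ‖y - j d‖ := by
          gcongr
          rw [div_le_iff₀ hpos]
          linarith
  have e3 : ‖h.res (hr n) (A d)‖ ≤ (|r n| - k)⁻¹ * ‖A d‖ :=
    (h.res (hr n)).le_of_opNorm_le (h.norm_res_le (hr n)) _
  rw [dist_eq_norm] at hd ⊢
  rw [e1]
  have e4 := norm_add_le ((r n : ℂ) • h.res (hr n) (y - j d) - (y - j d)) (h.res (hr n) (A d))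
  have e5 := norm_sub_le ((r n : ℂ) • h.res (hr n) (y - j d)) (y - j d)
  linarith

/-- On the domain, the symmetric Yosida approximation is the mean of `s R(s) A` and `-s R(-s) A`. -/
theorem yosida_map (h : IsQuasiSkewAdjoint j A k) {s : ℝ} (hs : k < |s|) (hs' : k < |-s|) (d : D) :
    h.yosida hs (j d) =
      (2⁻¹ : ℂ) • ((s : ℂ) • h.res hs (A d) + ((-s : ℝ) : ℂ) • h.res hs' (A d)) := by
  have h1 := h.res_map hs d
  have h2 := h.res_map hs' d
  have e1 : h.res hs (A d) = (s : ℂ) • h.res hs (j d) - j d := by rw [h1]; abel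
  have e2 : h.res hs' (A d) = ((-s : ℝ) : ℂ) • h.res hs' (j d) - j d := by rw [h2]; abel
  rw [e1, e2]
  simp only [yosida, _root_.smul_apply, _root_.add_apply]
  push_cast
  module

/-- A quasi-skew-adjoint operator is, on its domain, the derivative at `0` of a strongly continuous
group. -/
theorem exists_group [CompleteSpace H] (h : IsQuasiSkewAdjoint j A k) :
    ∃ S : C0Group H, (∀ t x, ‖S.op t x‖ ≤ Real.exp (k * |t|) * ‖x‖) ∧
      ∀ d, HasDerivAt (fun t => S.op t (j d)) (A d) 0 := by
  have hk := h.nonneg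
  let s : ℕ → ℝ := fun n => 2 * k + 1 + n
  have hs0 : ∀ n, 0 < s n := fun n => by positivity
  have habs : ∀ n, |s n| = s n := fun n => abs_of_pos (hs0 n)
  have h2s : ∀ n, 2 * k ≤ s n := fun n => by
    have : (0 : ℝ) ≤ n := n.cast_nonneg
    simp only [s]
    linarith
  have hs : ∀ n, k < |s n| := fun n => by
    have : (0 : ℝ) ≤ n := n.cast_nonneg
    rw [habs]
    simp only [s]
    linarith
  have hs' : ∀ n, k < |-s n| := fun n => by rw [abs_neg]; exact hs n
  have hlim : Tendsto (fun n => |s n|) atTop atTop := by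
    simp only [habs]
    exact tendsto_atTop_add_const_left atTop _ tendsto_natCast_atTop_atTop
  refine exists_group_of_tendsto h.denseRange (a := fun n => h.yosida (hs n))
    (fun m n => h.commute_yosida (hs m) (hs n)) hk
    (fun n u => h.re_inner_yosida_le (hs n) (h2s n) (hs0 n) u) fun d => ?_
  simp only [h.yosida_map (hs _) (hs' _)]
  have := ((h.tendsto_smul_res hs hlim (A d)).add (h.tendsto_smul_res hs'
    (by simpa only [abs_neg] using hlim) (A d))).const_smul (2⁻¹ : ℂ)
  rwa [← two_smul ℂ (A d), smul_smul, inv_mul_cancel₀ two_ne_zero, one_smul] at this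

/-- The right derivative of `U` at `0` does not properly extend the operator: solving `(r - A) d =
r x - y` for `r = k + 1`, the vector `z = x - j d` has the right derivative `r z`, and it vanishes
because `r` exceeds the growth rate `k` of `U`. -/
theorem mem_graph_of_tendsto (h : IsQuasiSkewAdjoint j A k) {U : ℝ → H →L[ℂ] H}
    (hb : ∀ t x, ‖U t x‖ ≤ Real.exp (k * |t|) * ‖x‖)
    (hd : ∀ d, Tendsto (fun t : ℝ => (t : ℂ)⁻¹ • (U t (j d) - j d)) (𝓝[>] 0) (𝓝 (A d))) {x y : H}
    (hxy : Tendsto (fun t : ℝ => (t : ℂ)⁻¹ • (U t x - x)) (𝓝[>] 0) (𝓝 y)) :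
    ∃ d, j d = x ∧ A d = y := by
  have hr : k < |k + 1| := (lt_add_one k).trans_le (le_abs_self _)
  obtain ⟨d, hdxy⟩ := h.surj _ hr (((k + 1 : ℝ) : ℂ) • x - y)
  set z := x - j d with hz
  have hrz : y - A d = ((k + 1 : ℝ) : ℂ) • z := by
    rw [hz, smul_sub, sub_eq_sub_iff_add_eq_add]
    have := sub_eq_sub_iff_add_eq_add.1 hdxy
    rw [add_comm, this]
  have hlim : Tendsto (fun t : ℝ => (⟪z, (t : ℂ)⁻¹ • (U t z - z)⟫).re) (𝓝[>] 0)
      (𝓝 ((k + 1) * ‖z‖ ^ 2)) := by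
    have h1 := hxy.sub (hd d)
    rw [hrz] at h1
    have h2 := (Complex.continuous_re.tendsto _).comp
      ((tendsto_const_nhds (x := z)).inner (𝕜 := ℂ) h1)
    have e1 : (⟪z, ((k + 1 : ℝ) : ℂ) • z⟫).re = (k + 1) * ‖z‖ ^ 2 := by
      rw [inner_smul_right, Complex.re_ofReal_mul, inner_self_eq_norm_sq_to_K]
      norm_cast
    rw [e1] at h2
    refine h2.congr fun t => ?_
    simp only [Function.comp_apply]
    rw [← smul_sub, hz, map_sub]
    congr 3
    abel
  have hlim2 : Tendsto (fun t : ℝ => t⁻¹ * (Real.exp (k * t) - 1) * ‖z‖ ^ 2) (𝓝[>] 0)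
      (𝓝 (k * ‖z‖ ^ 2)) := by
    have h1 : HasDerivAt (fun t : ℝ => Real.exp (k * t)) k 0 := by
      simpa using ((hasDerivAt_id (0 : ℝ)).const_mul k).exp
    have h2 := h1.tendsto_slope_zero_right
    simp only [zero_add, mul_zero, Real.exp_zero, smul_eq_mul] at h2
    exact h2.mul_const _
  have hle : (k + 1) * ‖z‖ ^ 2 ≤ k * ‖z‖ ^ 2 := by
    refine le_of_tendsto_of_tendsto hlim hlim2 ?_
    filter_upwards [self_mem_nhdsWithin] with t (ht : 0 < t)
    rw [← Complex.ofReal_inv, inner_smul_right, Complex.re_ofReal_mul, mul_assoc]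
    gcongr
    rw [inner_sub_right, Complex.sub_re]
    have e1 : (⟪z, U t z⟫).re ≤ Real.exp (k * t) * ‖z‖ ^ 2 := by
      have e2 := (Complex.re_le_norm _).trans (norm_inner_le_norm (𝕜 := ℂ) z (U t z))
      have e3 := hb t z
      rw [abs_of_pos ht] at e3
      nlinarith [norm_nonneg z]
    have e4 : (⟪z, z⟫).re = ‖z‖ ^ 2 := by
      rw [inner_self_eq_norm_sq_to_K]
      norm_cast
    linarith
  have hz0 : ‖z‖ ^ 2 = 0 := by nlinarith [sq_nonneg ‖z‖]
  have hz1 : z = 0 := norm_eq_zero.1 (pow_eq_zero_iff two_ne_zero |>.1 hz0)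
  refine ⟨d, (sub_eq_zero.1 hz1).symm, ?_⟩
  rw [hz1, smul_zero, sub_eq_zero] at hrz
  exact hrz.symm

theorem mem_graph_iff_tendsto (h : IsQuasiSkewAdjoint j A k) {U : ℝ → H →L[ℂ] H}
    (h0 : U 0 = 1) (hb : ∀ t x, ‖U t x‖ ≤ Real.exp (k * |t|) * ‖x‖)
    (hd : ∀ d, HasDerivAt (fun t => U t (j d)) (A d) 0) {l : Filter ℝ} (hl : 𝓝[>] 0 ≤ l)
    (hl' : l ≤ 𝓝[≠] 0) (x y : H) :
    (∃ d, j d = x ∧ A d = y) ↔ Tendsto (fun t : ℝ => (t : ℂ)⁻¹ • (U t x - x)) l (𝓝 y) := by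
  have hd' : ∀ d, Tendsto (fun t : ℝ => (t : ℂ)⁻¹ • (U t (j d) - j d)) (𝓝[≠] 0) (𝓝 (A d)) := by
    intro d
    refine (hasDerivAt_iff_tendsto_slope_zero.1 (hd d)).congr fun t => ?_
    rw [zero_add, h0, ← Complex.ofReal_inv, Complex.coe_smul]
    rfl
  constructor
  · rintro ⟨d, rfl, rfl⟩
    exact (hd' d).mono_left hl'
  · exact fun hxy => h.mem_graph_of_tendsto hb (fun d => (hd' d).mono_left (hl.trans hl'))
      (hxy.mono_left hl)

end IsQuasiSkewAdjoint

/-! ### Transport along an isomorphism -/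

variable {X : Type*} [NormedAddCommGroup X] [NormedSpace ℂ X]

/-- The group on `X` conjugate, under `e`, to a group on `H`. -/
def C0Group.conj (S : C0Group H) (e : X ≃L[ℂ] H) : C0Group X where
  op t := (e.symm : H →L[ℂ] X) ∘L S.op t ∘L (e : X →L[ℂ] H)
  op_zero := by ext x; simp [S.op_zero]
  op_add s t := by ext x; simp [S.op_add]
  continuous_op x := e.symm.continuous.comp (S.continuous_op (e x))

theorem C0Group.map_conj_op (S : C0Group H) (e : X ≃L[ℂ] H) (t : ℝ) (x : X) :
    e ((S.conj e).op t x) = S.op t (e x) :=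
  e.apply_symm_apply _

/-- The group `t ↦ S (-t)`. -/
def C0Group.reverse (S : C0Group X) : C0Group X where
  op t := S.op (-t)
  op_zero := by rw [neg_zero, S.op_zero]
  op_add s t := by rw [neg_add, S.op_add]
  continuous_op x := (S.continuous_op x).comp continuous_neg

/-- The restriction of a group to nonnegative times. -/
def C0Group.toC0Semigroup (S : C0Group X) : C0Semigroup X where
  op t := S.op t
  op_zero := S.op_zero
  op_add s t := by rw [NNReal.coe_add, S.op_add]
  continuous_op x := (S.continuous_op x).comp NNReal.continuous_coe

theorem NNReal.tendsto_comp_coe_nhdsGT_zero_iff {Y : Type*} {f : ℝ → Y} {l : Filter Y} :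
    Tendsto (fun t : ℝ≥0 => f t) (𝓝[>] 0) l ↔ Tendsto f (𝓝[>] 0) l := by
  constructor
  · intro h
    have h1 : Tendsto Real.toNNReal (𝓝[>] 0) (𝓝[>] 0) := by
      refine tendsto_nhdsWithin_iff.2 ⟨?_, ?_⟩
      · have := (continuous_real_toNNReal.tendsto 0).mono_left (nhdsWithin_le_nhds (s := Ioi 0))
        rwa [Real.toNNReal_zero] at this
      · filter_upwards [self_mem_nhdsWithin] with t ht
        exact Real.toNNReal_pos.2 ht
    refine (h.comp h1).congr' ?_
    filter_upwards [self_mem_nhdsWithin] with t ht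
    simp only [Function.comp_apply]
    rw [Real.coe_toNNReal _ (le_of_lt ht)]
  · intro h
    refine h.comp (tendsto_nhdsWithin_iff.2 ⟨?_, ?_⟩)
    · exact (NNReal.continuous_coe.tendsto 0).mono_left nhdsWithin_le_nhds
    · filter_upwards [self_mem_nhdsWithin] with t ht
      exact NNReal.coe_pos.2 ht

/-- An operator `A` on `X` which becomes quasi-skew-adjoint under an isomorphism onto a Hilbert
space generates a group, and `A` and `-A` generate its two halves. -/
theorem exists_generated_groups [CompleteSpace H] (e : X ≃L[ℂ] H) (A : X →ₗ.[ℂ] X)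
    (h : IsQuasiSkewAdjoint (e.toLinearEquiv.toLinearMap ∘ₗ A.domain.subtype)
      (e.toLinearEquiv.toLinearMap ∘ₗ A.toFun) k) :
    (∃ S : C0Semigroup X, S.IsGenerator A) ∧ (∃ S : C0Semigroup X, S.IsGenerator (-A)) ∧
      ∃ S : C0Group X, S.IsGenerator A ∧ ∀ t x, ‖e (S.op t x)‖ ≤ Real.exp (k * |t|) * ‖e x‖ := by
  obtain ⟨S, hS, hSd⟩ := h.exists_group
  have hgraph : ∀ x y : X, (x, y) ∈ A.graph ↔ ∃ d : A.domain,
      (e.toLinearEquiv.toLinearMap ∘ₗ A.domain.subtype) d = e x ∧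
        (e.toLinearEquiv.toLinearMap ∘ₗ A.toFun) d = e y := fun x y => by
    rw [LinearPMap.mem_graph_iff]
    refine exists_congr fun d => and_congr ?_ ?_
    · exact e.injective.eq_iff.symm
    · exact e.injective.eq_iff.symm
  have hgraph' : ∀ x y : X, (x, y) ∈ (-A).graph ↔ ∃ d : A.domain,
      (e.toLinearEquiv.toLinearMap ∘ₗ A.domain.subtype) d = e x ∧
        (-(e.toLinearEquiv.toLinearMap ∘ₗ A.toFun)) d = e y := fun x y => by
    rw [LinearPMap.mem_graph_iff]
    refine exists_congr fun d => and_congr ?_ ?_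
    · exact e.injective.eq_iff.symm
    · rw [LinearMap.neg_apply]
      change -(A d) = y ↔ -(e (A d)) = e y
      rw [← map_neg]
      exact e.injective.eq_iff.symm
  have htendsto : ∀ {ι : Type} (l : Filter ι) (c : ι → ℂ) (f : ι → X) (x y : X),
      Tendsto (fun t => c t • (f t - x)) l (𝓝 y) ↔
        Tendsto (fun t => c t • (e (f t) - e x)) l (𝓝 (e y)) := fun l c f x y => by
    rw [e.toHomeomorph.isInducing.tendsto_nhds_iff]
    refine tendsto_congr fun t => ?_
    simp
  have hrev : ∀ d : A.domain, HasDerivAt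
      (fun t => S.reverse.op t ((e.toLinearEquiv.toLinearMap ∘ₗ A.domain.subtype) d))
      ((-(e.toLinearEquiv.toLinearMap ∘ₗ A.toFun)) d) 0 := fun d => by
    have h1 := hSd d
    rw [← neg_zero] at h1
    have := h1.scomp (0 : ℝ) (hasDerivAt_neg (0 : ℝ))
    rwa [neg_one_smul] at this
  refine ⟨⟨(S.conj e).toC0Semigroup, fun x y => ?_⟩,
    ⟨(S.conj e).reverse.toC0Semigroup, fun x y => ?_⟩, S.conj e, fun x y => ?_, fun t x => ?_⟩
  · rw [hgraph, h.mem_graph_iff_tendsto S.op_zero hS hSd le_rfl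
      (nhdsWithin_mono _ fun t ht => ne_of_gt ht), htendsto,
      ← NNReal.tendsto_comp_coe_nhdsGT_zero_iff]
    exact tendsto_congr fun t => by rw [← S.map_conj_op]; rfl
  · rw [hgraph', h.neg.mem_graph_iff_tendsto S.reverse.op_zero
      (fun t x => (hS (-t) x).trans_eq (by rw [abs_neg])) hrev le_rfl
      (nhdsWithin_mono _ fun t ht => ne_of_gt ht), htendsto,
      ← NNReal.tendsto_comp_coe_nhdsGT_zero_iff]
    refine tendsto_congr fun t => ?_
    change _ • (S.op (-(t : ℝ)) (e x) - e x) = _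
    rw [← S.map_conj_op]
    rfl
  · rw [hgraph, h.mem_graph_iff_tendsto S.op_zero hS hSd
      (nhdsWithin_mono _ fun t ht => ne_of_gt ht) le_rfl, htendsto]
    exact tendsto_congr fun t => by rw [← S.map_conj_op]
  · rw [S.map_conj_op]
    exact hS t (e x)

end Generation

/-! ### Absolutely continuous functions with values in a normed space -/

section AbsolutelyContinuous

theorem IntervalIntegrable.absolutelyContinuousOnInterval_primitive {F : Type*}
    [NormedAddCommGroup F] [NormedSpace ℝ F] {f : ℝ → F} {a b c : ℝ}
    (hf : IntervalIntegrable f volume a b) (hc : c ∈ uIcc a b) :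
    AbsolutelyContinuousOnInterval (fun x => ∫ t in c..x, f t) a b := by
  have h := hf.norm.absolutelyContinuousOnInterval_intervalIntegral hc
  refine squeeze_zero' (Eventually.of_forall fun _ => Finset.sum_nonneg fun i _ => dist_nonneg)
    ?_ h
  rw [eventually_inf_principal]
  filter_upwards with I hI
  refine Finset.sum_le_sum fun i hi => ?_
  obtain ⟨h1, h2⟩ := hI.1 i hi
  have hint : ∀ x ∈ uIcc a b, IntervalIntegrable f volume c x := fun x hx =>
    hf.mono_set (uIcc_subset_uIcc hc hx)
  rw [dist_comm, dist_comm (∫ t in c..(I.2 i).1, ‖f t‖), dist_eq_norm, dist_eq_norm,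
    intervalIntegral.integral_interval_sub_left (hint _ h2) (hint _ h1),
    intervalIntegral.integral_interval_sub_left (hint _ h2).norm (hint _ h1).norm]
  exact intervalIntegral.norm_integral_le_abs_integral_norm

theorem IsBoundedBilinearMap.absolutelyContinuousOnInterval {𝕜 E F G : Type*}
    [NontriviallyNormedField 𝕜] [NormedAddCommGroup E] [NormedSpace 𝕜 E] [NormedAddCommGroup F]
    [NormedSpace 𝕜 F] [NormedAddCommGroup G] [NormedSpace 𝕜 G] {B : E × F → G}
    (hB : IsBoundedBilinearMap 𝕜 B) {f : ℝ → E} {g : ℝ → F} {a b : ℝ}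
    (hf : AbsolutelyContinuousOnInterval f a b) (hg : AbsolutelyContinuousOnInterval g a b) :
    AbsolutelyContinuousOnInterval (fun x => B (f x, g x)) a b := by
  obtain ⟨M, hM, hBM⟩ := hB.bound
  obtain ⟨C, hC⟩ := hf.exists_bound
  obtain ⟨C', hC'⟩ := hg.exists_bound
  unfold AbsolutelyContinuousOnInterval at hf hg
  refine squeeze_zero' (Eventually.of_forall fun _ => Finset.sum_nonneg fun i _ => dist_nonneg)
    ?_ (by simpa using (hg.const_mul (M * C)).add (hf.const_mul (M * C')))
  rw [eventually_inf_principal]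
  filter_upwards with I hI
  simp only [Finset.mul_sum, ← Finset.sum_add_distrib]
  refine Finset.sum_le_sum fun i hi => ?_
  obtain ⟨h1, h2⟩ := hI.1 i hi
  have e : B (f (I.2 i).1, g (I.2 i).1) - B (f (I.2 i).2, g (I.2 i).2) =
      B (f (I.2 i).1, g (I.2 i).1 - g (I.2 i).2) + B (f (I.2 i).1 - f (I.2 i).2, g (I.2 i).2) := by
    rw [hB.map_sub_right, hB.map_sub_left]
    abel
  rw [dist_eq_norm, e, dist_eq_norm, dist_eq_norm]
  refine (norm_add_le _ _).trans (add_le_add ((hBM _ _).trans ?_) ((hBM _ _).trans ?_))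
  · gcongr
    exact hC _ h1
  · rw [mul_right_comm]
    gcongr
    exact hC' _ h2

theorem AbsolutelyContinuousOnInterval.eq_add_integral {F : Type*} [NormedAddCommGroup F]
    [NormedSpace ℝ F] [CompleteSpace F] {f g : ℝ → F} {a b : ℝ}
    (hf : AbsolutelyContinuousOnInterval f a b) (hg : IntervalIntegrable g volume a b)
    (hfg : ∀ᵐ x, x ∈ uIcc a b → HasDerivAt f (g x) x) {x : ℝ} (hx : x ∈ uIcc a b) :
    f x = f a + ∫ t in a..x, g t := by
  have h1 := hf.sub (hg.absolutelyContinuousOnInterval_primitive left_mem_uIcc)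
  obtain ⟨C, hC⟩ := h1.const_of_ae_hasDerivAt_zero (by
    filter_upwards [hfg, hg.ae_hasDerivAt_integral] with y h2 h3 hy
    have := (h2 hy).sub (h3 hy a left_mem_uIcc)
    rwa [sub_self] at this)
  have e1 := hC x hx
  have e2 := hC a left_mem_uIcc
  simp only [Pi.sub_apply, intervalIntegral.integral_same, sub_zero] at e1 e2
  rw [e2, ← e1, sub_add_cancel]

theorem ae_restrict_Ioo_iff {a b : ℝ} {p : ℝ → Prop} (hab : a ≤ b) :
    (∀ᵐ x ∂(volume.restrict (Ioo a b)), p x) ↔ ∀ᵐ x, x ∈ uIcc a b → p x := by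
  rw [uIcc_of_le hab, restrict_Ioo_eq_restrict_Icc, ae_restrict_iff' measurableSet_Icc]

theorem AbsolutelyContinuousOnInterval.setIntegral_Ioo_eq_sub {F : Type*} [NormedAddCommGroup F]
    [NormedSpace ℝ F] [CompleteSpace F] {f g : ℝ → F} {a b : ℝ} (hab : a ≤ b)
    (hf : AbsolutelyContinuousOnInterval f a b)
    (hg : Integrable g (volume.restrict (Ioo a b)))
    (hfg : ∀ᵐ x ∂(volume.restrict (Ioo a b)), HasDerivAt f (g x) x) :
    ∫ x in Ioo a b, g x = f b - f a := by
  have hg' : IntervalIntegrable g volume a b :=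
    (intervalIntegrable_iff_integrableOn_Ioo_of_le hab).2 hg
  rw [hf.eq_add_integral hg' ((ae_restrict_Ioo_iff hab).1 hfg) right_mem_uIcc,
    intervalIntegral.integral_of_le hab, integral_Ioc_eq_integral_Ioo, add_sub_cancel_left]

end AbsolutelyContinuous

/-! ### Weak derivatives on an interval -/

section WeakDerivative

/-- An integrable function on `(0, ℓ)` annihilating the derivatives of all test functions is
constant: given a test function `η` of integral `1`, every test function `φ` is the sum of `(∫ φ)
η` and of the derivative of a test function. -/
theorem ae_eq_const_of_integral_deriv_smul_eq_zero {F : Type*} [NormedAddCommGroup F]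
    [NormedSpace ℝ F] [CompleteSpace F] {ℓ : ℝ} (hℓ : 0 < ℓ) {d : ℝ → F}
    (hd : Integrable d (volume.restrict (Ioo 0 ℓ)))
    (h : ∀ φ : ℝ → ℝ, ContDiff ℝ ∞ φ → HasCompactSupport φ → tsupport φ ⊆ Ioo 0 ℓ →
      ∫ x in Ioo 0 ℓ, deriv φ x • d x = 0) :
    ∃ c, ∀ᵐ x ∂(volume.restrict (Ioo 0 ℓ)), d x = c := by
  let b : ContDiffBump (ℓ / 2) := ⟨ℓ / 8, ℓ / 4, by positivity, by linarith⟩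
  set η : ℝ → ℝ := b.normed volume with hη
  have hη1 : ContDiff ℝ ∞ η := b.contDiff_normed
  have hη2 : HasCompactSupport η := b.hasCompactSupport_normed
  have hη3 : tsupport η ⊆ Ioo 0 ℓ := by
    rw [hη, b.tsupport_normed_eq]
    intro x hx
    rw [Metric.mem_closedBall, Real.dist_eq, abs_le] at hx
    change -(ℓ / 4) ≤ x - ℓ / 2 ∧ x - ℓ / 2 ≤ ℓ / 4 at hx
    exact ⟨by linarith [hx.1], by linarith [hx.2]⟩
  have hη4 : ∫ x, η x = 1 := b.integral_normed
  have hint : ∀ φ : ℝ → ℝ, Continuous φ → HasCompactSupport φ →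
      Integrable (fun x => φ x • d x) (volume.restrict (Ioo 0 ℓ)) := fun φ h1 h2 => by
    obtain ⟨C, hC⟩ := h1.bounded_above_of_compact_support h2
    exact hd.bdd_smul C h1.aestronglyMeasurable (Eventually.of_forall hC)
  set c : F := ∫ x in Ioo 0 ℓ, η x • d x with hc
  refine ⟨c, ?_⟩
  have hloc : LocallyIntegrableOn (fun x => d x - c) (Ioo 0 ℓ) volume :=
    IntegrableOn.locallyIntegrableOn (hd.sub (integrable_const c))
  have key := isOpen_Ioo.ae_eq_zero_of_integral_contDiff_smul_eq_zero hloc ?_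
  · rw [ae_restrict_iff' measurableSet_Ioo]
    filter_upwards [key] with x hx hx'
    exact sub_eq_zero.1 (hx hx')
  intro φ h1 h2 h3
  set m : ℝ := ∫ x, φ x with hm
  -- `θ` has integral `0`, so its primitive `ψ` is a test function
  set θ : ℝ → ℝ := fun x => φ x - m * η x with hθ
  have hθc : Continuous θ := h1.continuous.sub (continuous_const.mul hη1.continuous)
  have hθ0 : ∫ x, θ x = 0 := by
    rw [hθ, integral_sub (h1.continuous.integrable_of_hasCompactSupport h2)
      ((hη1.continuous.integrable_of_hasCompactSupport hη2).const_mul m), integral_const_mul, hη4,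
      mul_one, sub_self]
  -- the supports of `φ` and `η` lie in a compact subinterval `[α, β]`
  obtain ⟨α, β, hαβ, hα, hβ⟩ : ∃ α β, (∀ x, x ∉ Icc α β → θ x = 0) ∧ 0 < α ∧ β < ℓ := by
    have hK : IsCompact (tsupport φ ∪ tsupport η) :=
      h2.isCompact.union hη2.isCompact
    have hKs : tsupport φ ∪ tsupport η ⊆ Ioo 0 ℓ := union_subset h3 hη3
    have hKne : (tsupport φ ∪ tsupport η).Nonempty := by
      refine Nonempty.inr ?_
      rw [hη, b.tsupport_normed_eq]
      exact ⟨ℓ / 2, Metric.mem_closedBall_self b.rOut_pos.le⟩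
    refine ⟨sInf (tsupport φ ∪ tsupport η), sSup (tsupport φ ∪ tsupport η), fun x hx => ?_,
      (hKs (hK.sInf_mem hKne)).1, (hKs (hK.sSup_mem hKne)).2⟩
    have hx' : x ∉ tsupport φ ∪ tsupport η := fun hx' =>
      hx ⟨csInf_le hK.bddBelow hx', le_csSup hK.bddAbove hx'⟩
    rw [hθ]
    simp only
    rw [image_eq_zero_of_notMem_tsupport (fun hm => hx' (Or.inl hm)),
      image_eq_zero_of_notMem_tsupport (fun hm => hx' (Or.inr hm)), mul_zero, sub_zero]
  set ψ : ℝ → ℝ := fun x => ∫ t in (0 : ℝ)..x, θ t with hψ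
  have hψd : ∀ x, HasDerivAt ψ (θ x) x := fun x => hθc.integral_hasStrictDerivAt 0 x |>.hasDerivAt
  have hψd' : deriv ψ = θ := funext fun x => (hψd x).deriv
  have hψ1 : ContDiff ℝ ∞ ψ := by
    rw [contDiff_infty_iff_deriv, hψd']
    exact ⟨fun x => (hψd x).differentiableAt, h1.sub (contDiff_const.mul hη1)⟩
  have hψ0 : ∀ x, x ∉ Icc α β → ψ x = 0 := by
    intro x hx
    rcases lt_or_ge x α with hxα | hxα
    · refine (intervalIntegral.integral_congr (g := fun _ => (0 : ℝ)) fun t ht => ?_).trans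
        intervalIntegral.integral_zero
      refine hαβ t fun ht' => ?_
      have := ht.2
      exact absurd (ht'.1.trans this) (not_le.2 (max_lt hα hxα))
    · have hxβ : β < x := by
        by_contra hcon
        exact hx ⟨hxα, not_lt.1 hcon⟩
      have e1 : ∫ t in (0 : ℝ)..x, θ t = ∫ t, θ t := by
        rw [intervalIntegral.integral_of_le (hα.le.trans hxα)]
        refine setIntegral_eq_integral_of_forall_compl_eq_zero fun t ht => hαβ t fun ht' => ht ?_
        exact ⟨hα.trans_le ht'.1, ht'.2.trans hxβ.le⟩
      rw [hψ]
      simp only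
      rw [e1, hθ0]
  have hψ2 : tsupport ψ ⊆ Icc α β :=
    closure_minimal (fun x hx => by_contra fun hx' => hx (hψ0 x hx')) isClosed_Icc
  have hψ3 : HasCompactSupport ψ :=
    HasCompactSupport.of_support_subset_isCompact isCompact_Icc ((subset_tsupport ψ).trans hψ2)
  have h4 := h ψ hψ1 hψ3 (hψ2.trans fun x hx => ⟨hα.trans_le hx.1, hx.2.trans_lt hβ⟩)
  rw [hψd'] at h4
  have e1 : ∫ x in Ioo 0 ℓ, θ x • d x = (∫ x in Ioo 0 ℓ, φ x • d x) - m • c := by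
    have hi : Integrable (fun x => m • η x • d x) (volume.restrict (Ioo 0 ℓ)) :=
      (hint η hη1.continuous hη2).smul m
    rw [hc, ← integral_smul, ← integral_sub (hint φ h1.continuous h2) hi]
    refine integral_congr_ae (Eventually.of_forall fun x => ?_)
    simp only [hθ, sub_smul, mul_smul]
  have e2 : ∫ x in Ioo 0 ℓ, φ x = m := by
    rw [hm]
    exact setIntegral_eq_integral_of_forall_compl_eq_zero fun x hx =>
      image_eq_zero_of_notMem_tsupport fun hx' => hx (h3 hx')
  have e3 : ∫ x, φ x • (d x - c) = ∫ x in Ioo 0 ℓ, φ x • (d x - c) :=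
    (setIntegral_eq_integral_of_forall_compl_eq_zero fun x hx => by
      rw [image_eq_zero_of_notMem_tsupport fun hx' => hx (h3 hx'), zero_smul]).symm
  have hφi : Integrable φ (volume.restrict (Ioo 0 ℓ)) :=
    (h1.continuous.integrable_of_hasCompactSupport h2).integrableOn
  refine e3.trans ?_
  simp only [smul_sub]
  rw [integral_sub (hint φ h1.continuous h2) (hφi.smul_const c), integral_smul_const, e2, ← e1, h4]

variable {ℓ : ℝ} {n : ℕ}

theorem integrable_intervalL2 (u : IntervalL2 ℓ n) :
    Integrable u (volume.restrict (Ioo (0 : ℝ) ℓ)) :=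
  (Lp.memLp u).integrable one_le_two

/-- The classical derivative, almost everywhere, of an absolutely continuous function is its weak
derivative. -/
theorem AbsolutelyContinuousOnInterval.isWeakDeriv (hℓ : 0 < ℓ) {u g : IntervalL2 ℓ n}
    {w : ℝ → EuclideanSpace ℂ (Fin n)} (hw : AbsolutelyContinuousOnInterval w 0 ℓ)
    (huw : u =ᵐ[volume.restrict (Ioo (0 : ℝ) ℓ)] w)
    (hwg : ∀ᵐ x ∂(volume.restrict (Ioo 0 ℓ)), HasDerivAt w (g x) x) : IsWeakDeriv u g := by
  intro φ h1 h2 h3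
  have hφ : AbsolutelyContinuousOnInterval φ 0 ℓ := by
    obtain ⟨C, hC⟩ := ContDiff.lipschitzWith_of_hasCompactSupport h2 h1 (by simp)
    exact hC.lipschitzOnWith.absolutelyContinuousOnInterval
  have hi1 := integrable_smul_L2 u (h1.continuous_deriv (by simp)) h2.deriv
  have hi2 := integrable_smul_L2 g h1.continuous h2
  have h4 := (hφ.fun_smul hw).setIntegral_Ioo_eq_sub hℓ.le (hi2.add hi1) (by
    filter_upwards [huw, hwg] with x hx hx'
    have hd : HasDerivAt φ (deriv φ x) x :=
      (h1.differentiable (by simp) x).hasDerivAt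
    simp only [Pi.add_apply, hx]
    exact hd.smul hx')
  have e0 : φ 0 = 0 := image_eq_zero_of_notMem_tsupport fun hx => lt_irrefl _ (h3 hx).1
  have eℓ : φ ℓ = 0 := image_eq_zero_of_notMem_tsupport fun hx => lt_irrefl _ (h3 hx).2
  simp only [Pi.add_apply] at h4
  rw [e0, eℓ, zero_smul, zero_smul, sub_zero, integral_add hi2 hi1] at h4
  exact eq_neg_of_add_eq_zero_right h4

/-- An element of `H¹(0, ℓ)ⁿ` has an absolutely continuous representative. -/
theorem IsWeakDeriv.exists_absolutelyContinuous (hℓ : 0 < ℓ) {u g : IntervalL2 ℓ n}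
    (hug : IsWeakDeriv u g) :
    ∃ w : ℝ → EuclideanSpace ℂ (Fin n), AbsolutelyContinuousOnInterval w 0 ℓ ∧
      u =ᵐ[volume.restrict (Ioo (0 : ℝ) ℓ)] w ∧
      ∀ᵐ x ∂(volume.restrict (Ioo 0 ℓ)), HasDerivAt w (g x) x := by
  have hgi : IntervalIntegrable g volume 0 ℓ :=
    (intervalIntegrable_iff_integrableOn_Ioo_of_le hℓ.le).2 (integrable_intervalL2 g)
  set w₀ : ℝ → EuclideanSpace ℂ (Fin n) := fun x => ∫ t in (0 : ℝ)..x, g t with hw₀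
  have hac : AbsolutelyContinuousOnInterval w₀ 0 ℓ :=
    hgi.absolutelyContinuousOnInterval_primitive left_mem_uIcc
  have hder : ∀ᵐ x ∂(volume.restrict (Ioo 0 ℓ)), HasDerivAt w₀ (g x) x := by
    rw [ae_restrict_Ioo_iff hℓ.le]
    filter_upwards [hgi.ae_hasDerivAt_integral] with x hx hx'
    exact hx hx' 0 left_mem_uIcc
  have hcont : ContinuousOn w₀ (Icc 0 ℓ) := by
    simpa only [uIcc_of_le hℓ.le] using hac.continuousOn
  have hmem : MemLp w₀ 2 (volume.restrict (Ioo (0 : ℝ) ℓ)) := by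
    obtain ⟨C, hC⟩ := isCompact_Icc.exists_bound_of_continuousOn hcont
    exact MemLp.of_bound ((hcont.mono Ioo_subset_Icc_self).aestronglyMeasurable measurableSet_Ioo) C
      ((ae_restrict_iff' measurableSet_Ioo).2
        (Eventually.of_forall fun x hx => hC x (Ioo_subset_Icc_self hx)))
  obtain ⟨W, hW⟩ : ∃ W : IntervalL2 ℓ n, W =ᵐ[volume.restrict (Ioo (0 : ℝ) ℓ)] w₀ :=
    ⟨hmem.toLp w₀, hmem.coeFn_toLp⟩
  have hweak : IsWeakDeriv W g := hac.isWeakDeriv hℓ hW hder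
  obtain ⟨c, hc⟩ := ae_eq_const_of_integral_deriv_smul_eq_zero hℓ
    ((integrable_intervalL2 u).sub (integrable_intervalL2 W)) fun φ h1 h2 h3 => by
      simp only [Pi.sub_apply, smul_sub]
      have hd : Continuous (deriv φ) := h1.continuous_deriv (by simp)
      rw [integral_sub (integrable_smul_L2 u hd h2.deriv) (integrable_smul_L2 _ hd h2.deriv),
        hug φ h1 h2 h3, hweak φ h1 h2 h3, sub_self]
  refine ⟨fun x => c + w₀ x, ?_, ?_, ?_⟩
  · have hconst : AbsolutelyContinuousOnInterval (fun _ : ℝ => c) 0 ℓ :=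
      (LipschitzWith.const c).lipschitzOnWith.absolutelyContinuousOnInterval
    exact hconst.add hac
  · filter_upwards [hc, hW] with x hx hx'
    rw [Pi.sub_apply, hx'] at hx
    rw [← hx, sub_add_cancel]
  · filter_upwards [hder] with x hx
    exact hx.const_add c

theorem IsContRep.eqOn (hℓ : 0 < ℓ) {u : IntervalL2 ℓ n} {w z : ℝ → EuclideanSpace ℂ (Fin n)}
    (hw : IsContRep u w) (hz : IsContRep u z) : EqOn w z (Icc 0 ℓ) :=
  Measure.eqOn_Icc_of_ae_eq volume hℓ.ne (by
    rw [← restrict_Ioo_eq_restrict_Icc]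
    exact hw.2.symm.trans hz.2) hw.1 hz.1

/-- A weakly differentiable function has an absolutely continuous representative with the boundary
values of any given continuous one. -/
theorem IsWeakDeriv.exists_absolutelyContinuous_of_isContRep (hℓ : 0 < ℓ) {u g : IntervalL2 ℓ n}
    (hug : IsWeakDeriv u g) {w : ℝ → EuclideanSpace ℂ (Fin n)} (hw : IsContRep u w) :
    ∃ z : ℝ → EuclideanSpace ℂ (Fin n), AbsolutelyContinuousOnInterval z 0 ℓ ∧
      u =ᵐ[volume.restrict (Ioo (0 : ℝ) ℓ)] z ∧
      (∀ᵐ x ∂(volume.restrict (Ioo 0 ℓ)), HasDerivAt z (g x) x) ∧ z 0 = w 0 ∧ z ℓ = w ℓ := by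
  obtain ⟨z, h1, h2, h3⟩ := hug.exists_absolutelyContinuous hℓ
  have h4 := hw.eqOn hℓ (z := z) ⟨by simpa only [uIcc_of_le hℓ.le] using h1.continuousOn, h2⟩
  exact ⟨z, h1, h2, h3, (h4 (left_mem_Icc.2 hℓ.le)).symm, (h4 (right_mem_Icc.2 hℓ.le)).symm⟩

end WeakDerivative

/-! ### Multiplication by matrix-valued functions -/

section Multiplication

theorem LipschitzOnWith.ae_hasDerivAt_Ioo {F : Type*} [NormedAddCommGroup F] [NormedSpace ℝ F]
    [FiniteDimensional ℝ F] {f : ℝ → F} {C : ℝ≥0} {a b : ℝ} (hf : LipschitzOnWith C f (Icc a b)) :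
    ∀ᵐ x ∂(volume.restrict (Ioo a b)), HasDerivAt f (deriv f x) x := by
  rw [ae_restrict_iff' measurableSet_Ioo]
  filter_upwards [hf.ae_differentiableWithinAt_of_mem] with x hx hx'
  exact ((hx (Ioo_subset_Icc_self hx')).differentiableAt (Icc_mem_nhds hx'.1 hx'.2)).hasDerivAt

theorem LipschitzOnWith.memLp_top_deriv {F : Type*} [NormedAddCommGroup F] [NormedSpace ℝ F]
    [CompleteSpace F] {f : ℝ → F} {C : ℝ≥0} {a b : ℝ} (hf : LipschitzOnWith C f (Icc a b)) :
    MemLp (deriv f) ∞ (volume.restrict (Ioo a b)) :=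
  memLp_top_of_bound (aestronglyMeasurable_deriv f _) C
    ((ae_restrict_iff' measurableSet_Ioo).2 (Eventually.of_forall fun _ hx =>
      norm_deriv_le_of_lipschitzOn (Icc_mem_nhds hx.1 hx.2) hf))

theorem ContinuousOn.memLp_top_Ioo {F : Type*} [NormedAddCommGroup F] {f : ℝ → F} {a b : ℝ}
    (hf : ContinuousOn f (Icc a b)) : MemLp f ∞ (volume.restrict (Ioo a b)) := by
  obtain ⟨K, hK⟩ := isCompact_Icc.exists_bound_of_continuousOn hf
  exact memLp_top_of_bound
    ((hf.mono Ioo_subset_Icc_self).aestronglyMeasurable measurableSet_Ioo) K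
    ((ae_restrict_iff' measurableSet_Ioo).2
      (Eventually.of_forall fun x hx => hK x (Ioo_subset_Icc_self hx)))

theorem LipschitzOnWith.exists_mul {R : Type*} [NormedRing R] {f g : ℝ → R} {C C' : ℝ≥0} {a b : ℝ}
    (hf : LipschitzOnWith C f (Icc a b)) (hg : LipschitzOnWith C' g (Icc a b)) :
    ∃ K : ℝ≥0, LipschitzOnWith K (fun x => f x * g x) (Icc a b) := by
  obtain ⟨B, hB⟩ := isCompact_Icc.exists_bound_of_continuousOn hf.continuousOn
  obtain ⟨B', hB'⟩ := isCompact_Icc.exists_bound_of_continuousOn hg.continuousOn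
  refine ⟨(|B| * C' + C * |B'|).toNNReal, LipschitzOnWith.of_dist_le_mul fun x hx y hy => ?_⟩
  rw [Real.coe_toNNReal _ (by positivity), dist_eq_norm]
  have e : f x * g x - f y * g y = f x * (g x - g y) + (f x - f y) * g y := by noncomm_ring
  have h1 := hf.dist_le_mul x hx y hy
  have h2 := hg.dist_le_mul x hx y hy
  rw [dist_eq_norm] at h1 h2
  rw [e, add_mul]
  refine (norm_add_le _ _).trans (add_le_add ((norm_mul_le _ _).trans ?_)
    ((norm_mul_le _ _).trans ?_))
  · rw [mul_assoc]
    exact mul_le_mul ((hB x hx).trans (le_abs_self _)) h2 (norm_nonneg _) (abs_nonneg _)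
  · rw [mul_right_comm]
    exact mul_le_mul h1 ((hB' y hy).trans (le_abs_self _)) (norm_nonneg _) (by positivity)

theorem LipschitzOnWith.exists_ringInverse {R : Type*} [NormedRing R] [HasSummableGeomSeries R]
    {f : ℝ → R} {C : ℝ≥0} {a b : ℝ} (hf : LipschitzOnWith C f (Icc a b))
    (hu : ∀ x ∈ Icc a b, IsUnit (f x)) :
    ∃ K : ℝ≥0, LipschitzOnWith K (fun x => Ring.inverse (f x)) (Icc a b) := by
  have hc : ContinuousOn (fun x => Ring.inverse (f x)) (Icc a b) := fun x hx => by
    obtain ⟨y, hy⟩ := hu x hx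
    have h1 : ContinuousAt Ring.inverse (f x) := hy ▸ NormedRing.inverse_continuousAt y
    exact h1.comp_continuousWithinAt (hf.continuousOn x hx)
  obtain ⟨B, hB⟩ := isCompact_Icc.exists_bound_of_continuousOn hc
  refine ⟨(|B| * C * |B|).toNNReal, LipschitzOnWith.of_dist_le_mul fun x hx y hy => ?_⟩
  rw [Real.coe_toNNReal _ (by positivity), dist_eq_norm]
  have e : Ring.inverse (f x) - Ring.inverse (f y) =
      Ring.inverse (f x) * (f y - f x) * Ring.inverse (f y) := by
    rw [mul_sub, sub_mul, Ring.inverse_mul_cancel _ (hu x hx), one_mul, mul_assoc,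
      Ring.mul_inverse_cancel _ (hu y hy), mul_one]
  have h1 := hf.dist_le_mul y hy x hx
  rw [dist_eq_norm, dist_comm] at h1
  rw [e, mul_right_comm _ |B|, mul_assoc (|B|) _ (dist x y)]
  refine (norm_mul_le _ _).trans (mul_le_mul ((norm_mul_le _ _).trans ?_)
    ((hB y hy).trans (le_abs_self _)) (norm_nonneg _) (by positivity))
  exact mul_le_mul ((hB x hx).trans (le_abs_self _)) h1 (norm_nonneg _) (abs_nonneg _)

variable {ℓ : ℝ} {n : ℕ}

theorem norm_matOp_apply_le (A : Matrix (Fin n) (Fin n) ℂ) (ξ : EuclideanSpace ℂ (Fin n)) :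
    ‖matOp A ξ‖ ≤ ‖A‖ * ‖ξ‖ :=
  (matOp A).le_opNorm ξ

theorem inner_matOp_right {ι : Type*} [Fintype ι] [DecidableEq ι] (A : Matrix ι ι ℂ)
    (ξ η : EuclideanSpace ℂ ι) : inner ℂ ξ (matOp A η) = inner ℂ (matOp Aᴴ ξ) η := by
  have h : matOp Aᴴ = ContinuousLinearMap.adjoint (matOp A) :=
    map_star (Matrix.toEuclideanCLM (n := ι) (𝕜 := ℂ)) A
  rw [h, ContinuousLinearMap.adjoint_inner_left]

theorem matOp_mul_apply {ι : Type*} [Fintype ι] [DecidableEq ι] (A B : Matrix ι ι ℂ)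
    (ξ : EuclideanSpace ℂ ι) : matOp (A * B) ξ = matOp A (matOp B ξ) :=
  congrArg (fun T : EuclideanSpace ℂ ι →L[ℂ] EuclideanSpace ℂ ι => T ξ)
    (map_mul (Matrix.toEuclideanCLM (n := ι) (𝕜 := ℂ)) A B)

theorem matOp_one_apply {ι : Type*} [Fintype ι] [DecidableEq ι] (ξ : EuclideanSpace ℂ ι) :
    matOp (1 : Matrix ι ι ℂ) ξ = ξ :=
  congrArg (fun T : EuclideanSpace ℂ ι →L[ℂ] EuclideanSpace ℂ ι => T ξ)
    (map_one (Matrix.toEuclideanCLM (n := ι) (𝕜 := ℂ)))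

theorem matOp_add_apply {ι : Type*} [Fintype ι] [DecidableEq ι] (A B : Matrix ι ι ℂ)
    (ξ : EuclideanSpace ℂ ι) : matOp (A + B) ξ = matOp A ξ + matOp B ξ :=
  congrArg (fun T : EuclideanSpace ℂ ι →L[ℂ] EuclideanSpace ℂ ι => T ξ)
    (map_add (Matrix.toEuclideanCLM (n := ι) (𝕜 := ℂ)) A B)

theorem isBoundedBilinearMap_matOp : IsBoundedBilinearMap ℂ
    (fun p : Matrix (Fin n) (Fin n) ℂ × EuclideanSpace ℂ (Fin n) => matOp p.1 p.2) where
  add_left A B ξ := matOp_add_apply A B ξ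
  smul_left c A ξ := congrArg
    (fun T : EuclideanSpace ℂ (Fin n) →L[ℂ] EuclideanSpace ℂ (Fin n) => T ξ)
    (map_smul (Matrix.toEuclideanCLM (n := Fin n) (𝕜 := ℂ)) c A)
  add_right A ξ η := map_add (matOp A) ξ η
  smul_right c A ξ := map_smul (matOp A) c ξ
  bound := ⟨1, one_pos, fun A ξ => by
    rw [one_mul]
    exact norm_matOp_apply_le A ξ⟩

theorem HasDerivAt.matOp_apply {A : ℝ → Matrix (Fin n) (Fin n) ℂ} {A' : Matrix (Fin n) (Fin n) ℂ}
    {w : ℝ → EuclideanSpace ℂ (Fin n)} {w' : EuclideanSpace ℂ (Fin n)} {x : ℝ}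
    (hA : HasDerivAt A A' x) (hw : HasDerivAt w w' x) :
    HasDerivAt (fun y => matOp (A y) (w y)) (matOp A' (w x) + matOp (A x) w') x := by
  have h := (((isBoundedBilinearMap_matOp (n := n)).hasFDerivAt (A x, w x)).restrictScalars
    ℝ).comp_hasDerivAt x (hA.prodMk hw)
  rw [add_comm]
  exact h

theorem coeFn_mulL2 {A : ℝ → Matrix (Fin n) (Fin n) ℂ}
    (hA : MemLp A ∞ (volume.restrict (Ioo (0 : ℝ) ℓ))) (u : IntervalL2 ℓ n) :
    mulL2 A hA u =ᵐ[volume.restrict (Ioo (0 : ℝ) ℓ)] fun x => matOp (A x) (u x) :=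
  (memLp_matOp hA u).coeFn_toLp

theorem inner_mulL2_right {A : ℝ → Matrix (Fin n) (Fin n) ℂ}
    (hA : MemLp A ∞ (volume.restrict (Ioo (0 : ℝ) ℓ))) (v u : IntervalL2 ℓ n) :
    inner ℂ v (mulL2 A hA u) = ∫ x in Ioo 0 ℓ, inner ℂ (v x) (matOp (A x) (u x)) := by
  rw [L2.inner_def]
  refine integral_congr_ae ?_
  filter_upwards [coeFn_mulL2 hA u] with x hx
  rw [hx]

theorem inner_mulL2_comm {A : ℝ → Matrix (Fin n) (Fin n) ℂ}
    (hA : MemLp A ∞ (volume.restrict (Ioo (0 : ℝ) ℓ)))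
    (hh : ∀ x ∈ Icc 0 ℓ, (A x).IsHermitian) (v u : IntervalL2 ℓ n) :
    inner ℂ (mulL2 A hA v) u = inner ℂ v (mulL2 A hA u) := by
  rw [L2.inner_def, L2.inner_def]
  refine integral_congr_ae ?_
  filter_upwards [coeFn_mulL2 hA u, coeFn_mulL2 hA v, ae_restrict_mem measurableSet_Ioo]
    with x hu hv hx
  rw [hu, hv, inner_matOp_right, (hh x (Ioo_subset_Icc_self hx)).eq]

theorem mulL2_mulL2 {A B C : ℝ → Matrix (Fin n) (Fin n) ℂ}
    (hA : MemLp A ∞ (volume.restrict (Ioo (0 : ℝ) ℓ)))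
    (hB : MemLp B ∞ (volume.restrict (Ioo (0 : ℝ) ℓ)))
    (hC : MemLp C ∞ (volume.restrict (Ioo (0 : ℝ) ℓ)))
    (h : ∀ x ∈ Icc 0 ℓ, A x * B x = C x) (u : IntervalL2 ℓ n) :
    mulL2 A hA (mulL2 B hB u) = mulL2 C hC u := by
  refine Lp.ext ?_
  filter_upwards [coeFn_mulL2 hA (mulL2 B hB u), coeFn_mulL2 hB u, coeFn_mulL2 hC u,
    ae_restrict_mem measurableSet_Ioo] with x h1 h2 h3 hx
  rw [h1, h2, h3, ← h x (Ioo_subset_Icc_self hx), matOp_mul_apply]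

theorem mulL2_eq_self {A : ℝ → Matrix (Fin n) (Fin n) ℂ}
    (hA : MemLp A ∞ (volume.restrict (Ioo (0 : ℝ) ℓ)))
    (h : ∀ x ∈ Icc 0 ℓ, A x = 1) (u : IntervalL2 ℓ n) : mulL2 A hA u = u := by
  refine Lp.ext ?_
  filter_upwards [coeFn_mulL2 hA u, ae_restrict_mem measurableSet_Ioo] with x h1 hx
  rw [h1, h x (Ioo_subset_Icc_self hx), matOp_one_apply]

/-- Multiplication by an essentially bounded matrix-valued function, as a bounded operator. -/
def mulL2CLM (A : ℝ → Matrix (Fin n) (Fin n) ℂ)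
    (hA : MemLp A ∞ (volume.restrict (Ioo (0 : ℝ) ℓ))) : IntervalL2 ℓ n →L[ℂ] IntervalL2 ℓ n :=
  (mulL2 A hA).mkContinuous (eLpNormEssSup A (volume.restrict (Ioo (0 : ℝ) ℓ))).toReal fun u => by
    have hfin : eLpNormEssSup A (volume.restrict (Ioo (0 : ℝ) ℓ)) ≠ (⊤ : ℝ≥0∞) := by
      simpa using hA.2.ne
    refine Lp.norm_le_mul_norm_of_ae_le_mul ?_
    filter_upwards [coeFn_mulL2 hA u,
      ae_le_eLpNormEssSup (f := A) (μ := volume.restrict (Ioo (0 : ℝ) ℓ))] with x h1 h2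
    rw [h1]
    refine (norm_matOp_apply_le (A x) (u x)).trans
      (mul_le_mul_of_nonneg_right ?_ (norm_nonneg _))
    have := ENNReal.toReal_mono hfin h2
    rwa [toReal_enorm] at this

theorem AbsolutelyContinuousOnInterval.isContRep (hℓ : 0 < ℓ) {u : IntervalL2 ℓ n}
    {w : ℝ → EuclideanSpace ℂ (Fin n)} (hw : AbsolutelyContinuousOnInterval w 0 ℓ)
    (huw : u =ᵐ[volume.restrict (Ioo (0 : ℝ) ℓ)] w) : IsContRep u w :=
  ⟨by simpa only [uIcc_of_le hℓ.le] using hw.continuousOn, huw⟩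

theorem LipschitzOnWith.absolutelyContinuousOnInterval_matOp (hℓ : 0 < ℓ)
    {A : ℝ → Matrix (Fin n) (Fin n) ℂ} {C : ℝ≥0} (hC : LipschitzOnWith C A (Icc 0 ℓ))
    {w : ℝ → EuclideanSpace ℂ (Fin n)} (hw : AbsolutelyContinuousOnInterval w 0 ℓ) :
    AbsolutelyContinuousOnInterval (fun x => matOp (A x) (w x)) 0 ℓ :=
  isBoundedBilinearMap_matOp.absolutelyContinuousOnInterval
    (LipschitzOnWith.absolutelyContinuousOnInterval (K := C) (by rwa [uIcc_of_le hℓ.le])) hw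

/-- The product rule for the product of a Lipschitz continuous matrix and a function in `H¹`. -/
theorem IsWeakDeriv.mulL2 (hℓ : 0 < ℓ) {u g : IntervalL2 ℓ n} (hug : IsWeakDeriv u g)
    {A : ℝ → Matrix (Fin n) (Fin n) ℂ} {C : ℝ≥0} (hC : LipschitzOnWith C A (Icc 0 ℓ))
    (hA : MemLp A ∞ (volume.restrict (Ioo (0 : ℝ) ℓ))) :
    IsWeakDeriv (mulL2 A hA u) (mulL2 (deriv A) hC.memLp_top_deriv u + mulL2 A hA g) := by
  obtain ⟨w, h1, h2, h3⟩ := hug.exists_absolutelyContinuous hℓ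
  refine (hC.absolutelyContinuousOnInterval_matOp hℓ h1).isWeakDeriv hℓ ?_ ?_
  · filter_upwards [coeFn_mulL2 hA u, h2] with x e1 e2
    rw [e1, e2]
  · filter_upwards [h2, h3, hC.ae_hasDerivAt_Ioo, coeFn_mulL2 hC.memLp_top_deriv u,
      coeFn_mulL2 hA g, Lp.coeFn_add (_root_.mulL2 (deriv A) hC.memLp_top_deriv u)
        (_root_.mulL2 A hA g)] with x e1 e2 e3 e4 e5 e6
    rw [e6, Pi.add_apply, e4, e5, e1]
    exact e3.matOp_apply e2

/-- Integration by parts for the pairing with a Hermitian, Lipschitz continuous weight `A`. -/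
theorem inner_mulL2_add_inner_mulL2 (hℓ : 0 < ℓ) {u g v h : IntervalL2 ℓ n} (hug : IsWeakDeriv u g)
    (hvh : IsWeakDeriv v h) {A : ℝ → Matrix (Fin n) (Fin n) ℂ} {C : ℝ≥0}
    (hC : LipschitzOnWith C A (Icc 0 ℓ)) (hA : MemLp A ∞ (volume.restrict (Ioo (0 : ℝ) ℓ)))
    (hh : ∀ x ∈ Icc 0 ℓ, (A x).IsHermitian) {w z : ℝ → EuclideanSpace ℂ (Fin n)}
    (hw : IsContRep u w) (hz : IsContRep v z) :
    inner ℂ v (mulL2 A hA g) + inner ℂ (mulL2 A hA h) u =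
      inner ℂ (z ℓ) (matOp (A ℓ) (w ℓ)) - inner ℂ (z 0) (matOp (A 0) (w 0)) -
        inner ℂ (mulL2 (deriv A) hC.memLp_top_deriv v) u := by
  obtain ⟨w', w1, w2, w3, w4, w5⟩ := hug.exists_absolutelyContinuous_of_isContRep hℓ hw
  obtain ⟨z', z1, z2, z3, z4, z5⟩ := hvh.exists_absolutelyContinuous_of_isContRep hℓ hz
  have hac : AbsolutelyContinuousOnInterval (fun x => inner ℂ (matOp (A x) (z' x)) (w' x)) 0 ℓ :=
    isBoundedBilinearMap_inner (𝕜 := ℂ) |>.absolutelyContinuousOnInterval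
      (hC.absolutelyContinuousOnInterval_matOp hℓ z1) w1
  have hi1 := L2.integrable_inner (𝕜 := ℂ) (mulL2 A hA v) g
  have hi2 := L2.integrable_inner (𝕜 := ℂ) (mulL2 (deriv A) hC.memLp_top_deriv v) u
  have hi3 := L2.integrable_inner (𝕜 := ℂ) (mulL2 A hA h) u
  have key := hac.setIntegral_Ioo_eq_sub hℓ.le (hi1.add (hi2.add hi3)) (by
    filter_upwards [w2, w3, z2, z3, hC.ae_hasDerivAt_Ioo, coeFn_mulL2 hA v, coeFn_mulL2 hA h,
      coeFn_mulL2 hC.memLp_top_deriv v] with x e1 e2 e3 e4 e5 e6 e7 e8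
    simp only [Pi.add_apply]
    rw [e6, e7, e8, e1, e3, ← inner_add_left]
    exact (e5.matOp_apply e4).inner ℂ e2)
  rw [integral_add' hi1 (hi2.add hi3), integral_add' hi2 hi3, ← L2.inner_def, ← L2.inner_def,
    ← L2.inner_def, inner_mulL2_comm hA hh, w4, w5, z4, z5] at key
  rw [inner_matOp_right, inner_matOp_right, (hh ℓ (right_mem_Icc.2 hℓ.le)).eq,
    (hh 0 (left_mem_Icc.2 hℓ.le)).eq, ← key]
  ring

end Multiplication

/-! ### Positive operators as squares of isomorphisms -/

section Sqrt

/-- A bounded, coercive and positive form is the pullback of the inner product along an isomorphism,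
the square root of the associated operator. -/
theorem ContinuousLinearMap.IsPositive.exists_inner_equiv {H : Type*} [NormedAddCommGroup H]
    [InnerProductSpace ℂ H] [CompleteSpace H] {P : H →L[ℂ] H} (hP : P.IsPositive) {c : ℝ}
    (hc : 0 < c) (hcP : ∀ u, c * ‖u‖ ^ 2 ≤ (inner ℂ u (P u)).re) :
    ∃ e : H ≃L[ℂ] H, ∀ u v, inner ℂ (e u) (e v) = inner ℂ u (P v) := by
  have h0 : 0 ≤ P := ContinuousLinearMap.nonneg_iff_isPositive P |>.2 hP
  have hcA : (algebraMap ℝ (H →L[ℂ] H) c) ≤ P := by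
    rw [ContinuousLinearMap.le_def]
    refine ContinuousLinearMap.isPositive_iff_complex _ |>.2 fun u => ?_
    have e1 : inner ℂ ((P - algebraMap ℝ (H →L[ℂ] H) c) u) u =
        (((inner ℂ u (P u)).re - c * ‖u‖ ^ 2 : ℝ) : ℂ) := by
      have e2 : inner ℂ (P u) u = ((inner ℂ u (P u)).re : ℂ) := by
        have h1 := (ContinuousLinearMap.isPositive_iff_complex P |>.1 hP u).1
        rw [← h1, ← inner_conj_symm u (P u), Complex.conj_re]
        rfl
      have e3 : (algebraMap ℝ (H →L[ℂ] H) c) u = (c : ℂ) • u := by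
        rw [Algebra.algebraMap_eq_smul_one, Complex.coe_smul]
        rfl
      rw [_root_.sub_apply, inner_sub_left, e2, e3, inner_smul_left, Complex.conj_ofReal,
        inner_self_eq_norm_sq_to_K]
      push_cast
      rfl
    rw [e1]
    rw [RCLike.re_eq_complex_re, Complex.ofReal_re]
    exact ⟨rfl, sub_nonneg.2 (hcP u)⟩
  have hunit : IsUnit P := by
    refine CStarAlgebra.isUnit_of_le _ hcA ?_
    refine IsStrictlyPositive.iff_of_unital.2 ⟨?_, ?_⟩
    · exact algebraMap_nonneg _ hc.le
    · exact (IsUnit.mk0 c hc.ne').map (algebraMap ℝ (H →L[ℂ] H))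
  have hR := (CFC.isUnit_sqrt_iff P h0).2 hunit
  obtain ⟨R, hR'⟩ := hR
  refine ⟨ContinuousLinearEquiv.unitsEquiv ℂ H R, fun u v => ?_⟩
  have hsa : IsSelfAdjoint (CFC.sqrt P) := IsSelfAdjoint.of_nonneg (CFC.sqrt_nonneg P)
  have e1 : ∀ w, ContinuousLinearEquiv.unitsEquiv ℂ H R w = CFC.sqrt P w := fun w => by
    rw [← hR']
    rfl
  rw [e1, e1, ← ContinuousLinearMap.adjoint_inner_right]
  have e2 : ContinuousLinearMap.adjoint (CFC.sqrt P) = CFC.sqrt P := hsa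
  rw [e2]
  congr 1
  exact congrArg (fun T : H →L[ℂ] H => T v) (CFC.sqrt_mul_sqrt_self P h0)

/-- An operator which is skew-adjoint up to a bounded operator with respect to the form defined by
`P` is quasi-skew-adjoint after transport to the inner product of the Hilbert space. -/
theorem IsQuasiSkewAdjoint.of_form {H D : Type*} [NormedAddCommGroup H] [InnerProductSpace ℂ H]
    [CompleteSpace H] [AddCommGroup D] [Module ℂ D] {j A : D →ₗ[ℂ] H} {P K : H →L[ℂ] H}
    {e : H ≃L[ℂ] H} (he : ∀ u v, inner ℂ (e u) (e v) = inner ℂ u (P v))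
    (hinj : Function.Injective j)
    (h1 : ∀ u v, inner ℂ (j v) (P (A u)) + inner ℂ (P (A v)) (j u) = inner ℂ (K (j v)) (j u))
    (h2 : ∀ x y, (∀ u, inner ℂ x (P (A u)) = inner ℂ y (j u)) →
      ∃ v, j v = x ∧ P (A v) = K x - y) :
    IsQuasiSkewAdjoint (e.toLinearEquiv.toLinearMap ∘ₗ j) (e.toLinearEquiv.toLinearMap ∘ₗ A)
      ‖ContinuousLinearMap.adjoint (e.symm : H →L[ℂ] H) ∘L K ∘L (e.symm : H →L[ℂ] H)‖ := by
  have he' : ∀ u v, inner ℂ (e u) (e v) = inner ℂ (P u) v := fun u v => by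
    rw [← inner_conj_symm, he, inner_conj_symm]
  have hK : ∀ x u, inner ℂ ((ContinuousLinearMap.adjoint (e.symm : H →L[ℂ] H) ∘L K ∘L
      (e.symm : H →L[ℂ] H)) (e x)) (e u) = inner ℂ (K x) u := fun x u => by
    simp [ContinuousLinearMap.adjoint_inner_left]
  refine IsQuasiSkewAdjoint.of_adjoint (e.injective.comp hinj) (fun u v => ?_) fun x y hxy => ?_
  · change inner ℂ (e (j v)) (e (A u)) + inner ℂ (e (A v)) (e (j u)) =
      inner ℂ ((ContinuousLinearMap.adjoint (e.symm : H →L[ℂ] H) ∘L K ∘L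
        (e.symm : H →L[ℂ] H)) (e (j v))) (e (j u))
    rw [hK, he, he', h1]
  · obtain ⟨x', rfl⟩ := e.surjective x
    obtain ⟨v, hv, hAv⟩ := h2 x' (ContinuousLinearMap.adjoint (e : H →L[ℂ] H) y) fun u => by
      rw [← he, ContinuousLinearMap.adjoint_inner_left]
      exact hxy u
    refine ⟨v, congrArg e hv, ext_inner_right ℂ fun w => ?_⟩
    obtain ⟨w', rfl⟩ := e.surjective w
    change inner ℂ (e (A v)) (e w') = _
    rw [he', hAv, inner_sub_left, inner_sub_left, hK, ContinuousLinearMap.adjoint_inner_left]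
    rfl

end Sqrt

/-! ### Linear algebra at the vertices -/

/-- Polarization: if the quadratic form of `T` vanishes on a complex subspace, so does the
sesquilinear form. No symmetry of `T` is needed. -/
theorem inner_map_eq_zero_of_isotropic {E : Type*} [NormedAddCommGroup E] [InnerProductSpace ℂ E]
    (T : E →L[ℂ] E) {W : Submodule ℂ E} (h : ∀ ξ ∈ W, inner ℂ ξ (T ξ) = 0) {ξ η : E} (hξ : ξ ∈ W)
    (hη : η ∈ W) : inner ℂ ξ (T η) = 0 := by
  have h1 := h _ (W.add_mem hξ hη)
  have h2 := h _ (W.add_mem hξ (W.smul_mem Complex.I hη))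
  simp only [map_add, map_smul, inner_add_left, inner_add_right, inner_smul_left, inner_smul_right,
    h ξ hξ, h η hη, Complex.conj_I, mul_zero, add_zero, zero_add] at h1 h2
  have h3 : Complex.I * (2 * inner ℂ ξ (T η)) = 0 := by linear_combination h2 + Complex.I * h1
  simpa using h3

namespace HyperbolicNetwork

variable {V E : Type*} (G : HyperbolicNetwork V E)

theorem isUnit_Q (e : E) {x : ℝ} (hx : x ∈ Icc 0 (G.len e)) : IsUnit (G.Q e x) := by
  obtain ⟨q, hq, h⟩ := G.Q_pos e
  rw [← Matrix.mulVec_injective_iff_isUnit, ← Matrix.coe_mulVecLin,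
    injective_iff_map_eq_zero]
  intro ξ hξ
  have h1 := h x hx (WithLp.toLp 2 ξ)
  have h2 : matOp (G.Q e x) (WithLp.toLp 2 ξ) = 0 := by
    rw [matOp, Matrix.toEuclideanCLM_toLp]
    exact congrArg (WithLp.toLp 2) hξ
  rw [h2, inner_zero_right, Complex.zero_re] at h1
  have h3 : ‖(WithLp.toLp 2 ξ : EuclideanSpace ℂ (Fin (G.k e)))‖ ^ 2 = 0 := by
    nlinarith [sq_nonneg ‖(WithLp.toLp 2 ξ : EuclideanSpace ℂ (Fin (G.k e)))‖]
  have h4 := norm_eq_zero.1 (pow_eq_zero_iff two_ne_zero |>.1 h3)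
  exact congrArg WithLp.ofLp h4

theorem isUnit_QM (e : E) {x : ℝ} (hx : x ∈ Icc 0 (G.len e)) : IsUnit (G.Q e x * G.M e x) :=
  (G.isUnit_Q e hx).mul (G.M_invertible e x hx)

theorem endPos_mem (h : E × Bool) : G.endPos h ∈ Icc 0 (G.len h.1) := by
  have := (G.len_pos h.1).le
  unfold endPos
  split_ifs
  · exact right_mem_Icc.2 this
  · exact left_mem_Icc.2 this

theorem endSign_mul_self (h : E × Bool) : endSign h * endSign h = 1 := by
  unfold endSign
  split_ifs <;> norm_num

theorem T_isHermitian [DecidableEq E] [DecidableEq V] (v : V) : (G.T v)ᴴ = G.T v := by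
  rw [T, Matrix.blockDiagonal'_conjTranspose]
  congr 1
  funext h
  have hs : star (endSign h.1) = endSign h.1 := by
    unfold endSign
    split_ifs <;> simp
  rw [Matrix.conjTranspose_smul, hs, (G.QM_hermitian h.1.1 _ (G.endPos_mem h.1)).eq]

section Vertex

variable [Fintype E] [DecidableEq E] [DecidableEq V]

theorem T_mul_inv (v : V) : G.T v * (G.T v)⁻¹ = 1 := by
  have h : G.T v * Matrix.blockDiagonal' (fun h : G.Ends v => endSign h.1 •
      (G.Q h.1.1 (G.endPos h.1) * G.M h.1.1 (G.endPos h.1))⁻¹) = 1 := by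
    rw [T, ← Matrix.blockDiagonal'_mul, ← Matrix.blockDiagonal'_one]
    congr 1
    funext h
    have hu := G.isUnit_QM h.1.1 (G.endPos_mem h.1)
    rw [Matrix.smul_mul, Matrix.mul_smul, smul_smul, endSign_mul_self, one_smul,
      Matrix.mul_nonsing_inv _ ((Matrix.isUnit_iff_isUnit_det _).1 hu)]
    rfl
  rw [Matrix.inv_eq_right_inv h, h]

theorem inv_mul_T (v : V) : (G.T v)⁻¹ * G.T v = 1 :=
  mul_eq_one_comm.1 (G.T_mul_inv v)

/-- If `T⁻¹ Y^⊥` is totally isotropic, then `⟪η', T⁻¹ η⟫ = 0` for all `η, η' ∈ Y^⊥`, that is,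
`T⁻¹ Y^⊥ ⊆ Y^⊥^⊥ = Y`. -/
theorem dualBoundarySpace_le {v : V} {Y : Submodule ℂ (G.VertexSpace v)}
    (hY' : G.IsTotallyIsotropic v (G.dualBoundarySpace v Y)) : G.dualBoundarySpace v Y ≤ Y := by
  rintro _ ⟨η, hη, rfl⟩
  rw [← Submodule.orthogonal_orthogonal Y]
  intro η' hη'
  have hT : ∀ ζ, matOp (G.T v) (matOp (G.T v)⁻¹ ζ) = ζ := fun ζ => by
    rw [← matOp_mul_apply, T_mul_inv, matOp_one_apply]
  have h1 := inner_map_eq_zero_of_isotropic (matOp (G.T v)) hY'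
    (Submodule.mem_map_of_mem hη : _ ∈ G.dualBoundarySpace v Y)
    (Submodule.mem_map_of_mem hη' : _ ∈ G.dualBoundarySpace v Y)
  change inner ℂ (matOp (G.T v)⁻¹ η) (matOp (G.T v) (matOp (G.T v)⁻¹ η')) = 0 at h1
  rw [hT] at h1
  change inner ℂ η' (matOp (G.T v)⁻¹ η) = 0
  rw [← inner_conj_symm, h1, map_zero]

theorem matOp_T_apply (v : V) (ξ : G.VertexSpace v) (h : G.Ends v) (i : Fin (G.k h.1.1)) :
    matOp (G.T v) ξ ⟨h, i⟩ = endSign h.1 *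
      matOp (G.Q h.1.1 (G.endPos h.1) * G.M h.1.1 (G.endPos h.1))
        (WithLp.toLp 2 fun j => ξ ⟨h, j⟩) i := by
  rw [matOp, matOp, Matrix.ofLp_toEuclideanCLM, Matrix.ofLp_toEuclideanCLM]
  simp only [Matrix.mulVec, dotProduct]
  rw [Fintype.sum_sigma, Finset.sum_eq_single h, Finset.mul_sum]
  · refine Finset.sum_congr rfl fun j _ => ?_
    rw [T, Matrix.blockDiagonal'_apply_eq, Matrix.smul_apply, smul_eq_mul, mul_assoc]
  · intro h' _ hne
    refine Finset.sum_eq_zero fun j _ => ?_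
    rw [T, Matrix.blockDiagonal'_apply_ne _ _ _ hne.symm, zero_mul]
  · exact fun hcon => absurd (Finset.mem_univ h) hcon

theorem inner_trace_T (v : V) (z w : ∀ e, ℝ → EuclideanSpace ℂ (Fin (G.k e))) :
    inner ℂ (G.trace v z) (matOp (G.T v) (G.trace v w)) =
      ∑ h : G.Ends v, endSign h.1 * inner ℂ (z h.1.1 (G.endPos h.1))
        (matOp (G.Q h.1.1 (G.endPos h.1) * G.M h.1.1 (G.endPos h.1))
          (w h.1.1 (G.endPos h.1))) := by
  rw [PiLp.inner_apply, Fintype.sum_sigma]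
  refine Finset.sum_congr rfl fun h _ => ?_
  rw [PiLp.inner_apply, Finset.mul_sum]
  refine Finset.sum_congr rfl fun i _ => ?_
  rw [matOp_T_apply, ← smul_eq_mul, inner_smul_right]
  rfl

/-- The boundary terms at the ends of all edges, sorted by vertices. -/
theorem sum_inner_trace_T [Fintype V] (z w : ∀ e, ℝ → EuclideanSpace ℂ (Fin (G.k e))) :
    ∑ v, inner ℂ (G.trace v z) (matOp (G.T v) (G.trace v w)) =
      ∑ e, (inner ℂ (z e (G.len e)) (matOp (G.Q e (G.len e) * G.M e (G.len e)) (w e (G.len e))) -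
        inner ℂ (z e 0) (matOp (G.Q e 0 * G.M e 0) (w e 0))) := by
  simp only [inner_trace_T]
  rw [← Fintype.sum_sigma' (fun (v : V) (h : G.Ends v) => endSign h.1 *
    inner ℂ (z h.1.1 (G.endPos h.1)) (matOp (G.Q h.1.1 (G.endPos h.1) * G.M h.1.1 (G.endPos h.1))
      (w h.1.1 (G.endPos h.1))))]
  refine ((Equiv.sigmaFiberEquiv G.endVertex).sum_comp (fun h : E × Bool => endSign h *
    inner ℂ (z h.1 (G.endPos h)) (matOp (G.Q h.1 (G.endPos h) * G.M h.1 (G.endPos h))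
      (w h.1 (G.endPos h))))).trans ?_
  rw [Fintype.sum_prod_type]
  refine Finset.sum_congr rfl fun e _ => ?_
  rw [Fintype.sum_bool]
  simp [endSign, endPos, sub_eq_add_neg]

end Vertex

/-! ### Multiplication operators on the network -/

theorem exists_lipschitzOnWith_QM (e : E) :
    ∃ C : ℝ≥0, LipschitzOnWith C (fun x => G.Q e x * G.M e x) (Icc 0 (G.len e)) := by
  obtain ⟨C, hC⟩ := G.Q_lipschitz e
  obtain ⟨C', hC'⟩ := G.M_lipschitz e
  exact hC.exists_mul hC'

theorem Q_bounded (e : E) : MemLp (G.Q e) ∞ (volume.restrict (Ioo 0 (G.len e))) :=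
  (G.Q_lipschitz e).choose_spec.continuousOn.memLp_top_Ioo

theorem QM_bounded (e : E) :
    MemLp (fun x => G.Q e x * G.M e x) ∞ (volume.restrict (Ioo 0 (G.len e))) :=
  (G.exists_lipschitzOnWith_QM e).choose_spec.continuousOn.memLp_top_Ioo

theorem deriv_QM_bounded (e : E) :
    MemLp (deriv fun x => G.Q e x * G.M e x) ∞ (volume.restrict (Ioo 0 (G.len e))) :=
  (G.exists_lipschitzOnWith_QM e).choose_spec.memLp_top_deriv

theorem le_re_inner_mulL2_Q {e : E} {q : ℝ} (h : ∀ x ∈ Icc 0 (G.len e),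
    ∀ ξ : EuclideanSpace ℂ (Fin (G.k e)), q * ‖ξ‖ ^ 2 ≤ (inner ℂ ξ (matOp (G.Q e x) ξ)).re)
    (u : IntervalL2 (G.len e) (G.k e)) :
    q * ‖u‖ ^ 2 ≤ (inner ℂ u (mulL2 (G.Q e) (G.Q_bounded e) u)).re := by
  have e1 : ‖u‖ ^ 2 = ∫ x in Ioo 0 (G.len e), (inner ℂ (u x) (u x)).re := by
    have h1 : ‖u‖ ^ 2 = (inner ℂ u u).re := by
      rw [inner_self_eq_norm_sq_to_K]
      norm_cast
    rw [h1, L2.inner_def]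
    exact (integral_re (L2.integrable_inner (𝕜 := ℂ) u u)).symm
  have e2 : (inner ℂ u (mulL2 (G.Q e) (G.Q_bounded e) u)).re =
      ∫ x in Ioo 0 (G.len e), (inner ℂ (u x) (mulL2 (G.Q e) (G.Q_bounded e) u x)).re := by
    rw [L2.inner_def]
    exact (integral_re (L2.integrable_inner (𝕜 := ℂ) u _)).symm
  rw [e1, e2, ← integral_const_mul]
  refine integral_mono_ae ((L2.integrable_inner (𝕜 := ℂ) u u).re.const_mul q)
    (L2.integrable_inner (𝕜 := ℂ) u _).re ?_
  filter_upwards [coeFn_mulL2 (G.Q_bounded e) u, ae_restrict_mem measurableSet_Ioo] with x h1 hx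
  have e3 : (inner ℂ (u x) (u x)).re = ‖u x‖ ^ 2 := by
    rw [inner_self_eq_norm_sq_to_K]
    norm_cast
  rw [h1, e3]
  exact h x (Ioo_subset_Icc_self hx) (u x)

/-- Weak differentiability of `Q M x` passes to `x`, because `Q M` has a Lipschitz continuous
inverse. -/
theorem mem_sobolevH1_of_isWeakDeriv {e : E} {x g : IntervalL2 (G.len e) (G.k e)}
    (h : IsWeakDeriv (mulL2 (fun x => G.Q e x * G.M e x) (G.QM_bounded e) x) g) :
    x ∈ sobolevH1 (G.len e) (G.k e) := by
  obtain ⟨C, hC⟩ := G.exists_lipschitzOnWith_QM e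
  obtain ⟨C', hC'⟩ := hC.exists_ringInverse fun t ht => G.isUnit_QM e ht
  have h1 := h.mulL2 (G.len_pos e) hC' hC'.continuousOn.memLp_top_Ioo
  rw [mulL2_mulL2 _ (G.QM_bounded e) (C := fun _ => 1) continuousOn_const.memLp_top_Ioo
    fun t ht => Ring.inverse_mul_cancel _ (G.isUnit_QM e ht),
    mulL2_eq_self _ fun _ _ => rfl] at h1
  exact ⟨_, h1⟩

variable [Fintype E]

/-- Multiplication by a bounded matrix-valued function on each edge, as an operator on `𝐋²(𝒢)`. -/
def mulOp (A : ∀ e, ℝ → Matrix (Fin (G.k e)) (Fin (G.k e)) ℂ)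
    (hA : ∀ e, MemLp (A e) ∞ (volume.restrict (Ioo 0 (G.len e)))) : G.L2 →L[ℂ] G.L2 :=
  ((PiLp.continuousLinearEquiv 2 ℂ fun e => IntervalL2 (G.len e) (G.k e)).symm :
      (∀ e, IntervalL2 (G.len e) (G.k e)) →L[ℂ] G.L2) ∘L
    ContinuousLinearMap.pi fun e => mulL2CLM (A e) (hA e) ∘L ContinuousLinearMap.proj e ∘L
      ((PiLp.continuousLinearEquiv 2 ℂ fun e => IntervalL2 (G.len e) (G.k e)) :
        G.L2 →L[ℂ] ∀ e, IntervalL2 (G.len e) (G.k e))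

theorem mulOp_apply (A : ∀ e, ℝ → Matrix (Fin (G.k e)) (Fin (G.k e)) ℂ)
    (hA : ∀ e, MemLp (A e) ∞ (volume.restrict (Ioo 0 (G.len e)))) (u : G.L2) (e : E) :
    G.mulOp A hA u e = mulL2 (A e) (hA e) (u e) := rfl

theorem energyInner_eq (u v : G.L2) :
    G.energyInner u v = inner ℂ v (G.mulOp G.Q G.Q_bounded u) := by
  rw [PiLp.inner_apply, energyInner]
  exact Finset.sum_congr rfl fun e _ => (inner_mulL2_right (G.Q_bounded e) (v e) (u e)).symm

theorem inner_mulOp_comm (A : ∀ e, ℝ → Matrix (Fin (G.k e)) (Fin (G.k e)) ℂ)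
    (hA : ∀ e, MemLp (A e) ∞ (volume.restrict (Ioo 0 (G.len e))))
    (hh : ∀ e, ∀ x ∈ Icc 0 (G.len e), (A e x).IsHermitian) (u v : G.L2) :
    inner ℂ (G.mulOp A hA v) u = inner ℂ v (G.mulOp A hA u) := by
  rw [PiLp.inner_apply, PiLp.inner_apply]
  exact Finset.sum_congr rfl fun e _ => inner_mulL2_comm (hA e) (hh e) (v e) (u e)

theorem mulOp_Q_mulOp_M (u : G.L2) : G.mulOp G.Q G.Q_bounded (G.mulOp G.M G.M_bounded u) =
    G.mulOp (fun e x => G.Q e x * G.M e x) G.QM_bounded u := by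
  ext1 e
  exact mulL2_mulL2 (G.Q_bounded e) (G.M_bounded e) (G.QM_bounded e) (fun _ _ => rfl) (u e)

theorem exists_le_re_inner_mulOp_Q [Nonempty E] : ∃ c : ℝ, 0 < c ∧
    ∀ u : G.L2, c * ‖u‖ ^ 2 ≤ (inner ℂ u (G.mulOp G.Q G.Q_bounded u)).re := by
  choose q hq h using G.Q_pos
  obtain ⟨e₀, he₀⟩ := Finite.exists_min q
  refine ⟨q e₀, hq e₀, fun u => ?_⟩
  rw [PiLp.inner_apply, Complex.re_sum, PiLp.norm_sq_eq_of_L2, Finset.mul_sum]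
  exact Finset.sum_le_sum fun e _ =>
    (mul_le_mul_of_nonneg_right (he₀ e) (sq_nonneg _)).trans (G.le_re_inner_mulL2_Q (h e) (u e))

theorem isPositive_mulOp_Q : (G.mulOp G.Q G.Q_bounded).IsPositive := by
  refine ContinuousLinearMap.isPositive_iff_complex _ |>.2 fun u => ?_
  have h1 := G.inner_mulOp_comm G.Q G.Q_bounded G.Q_hermitian u u
  have h2 : 0 ≤ (inner ℂ u (G.mulOp G.Q G.Q_bounded u)).re := by
    rw [PiLp.inner_apply, Complex.re_sum]
    refine Finset.sum_nonneg fun e _ => ?_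
    obtain ⟨q, hq, h⟩ := G.Q_pos e
    exact (by positivity : (0 : ℝ) ≤ q * ‖u e‖ ^ 2).trans (G.le_re_inner_mulL2_Q h (u e))
  refine ⟨?_, by rw [h1]; exact h2⟩
  have h3 : (starRingEnd ℂ) (inner ℂ (G.mulOp G.Q G.Q_bounded u) u) =
      inner ℂ (G.mulOp G.Q G.Q_bounded u) u := by
    rw [inner_conj_symm, h1]
  exact Complex.conj_eq_iff_re.1 h3

/-! ### The operator and its adjoint with respect to the energy -/

/-- The derivative of an element of the domain, edge by edge. -/
def edgeDeriv {Y : ∀ v, Submodule ℂ (G.VertexSpace v)} (u : G.domain Y) : G.L2 :=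
  WithLp.toLp 2 fun e => weakDeriv ⟨u.1 e, u.2.1 e⟩

theorem isWeakDeriv_edgeDeriv {Y : ∀ v, Submodule ℂ (G.VertexSpace v)} (u : G.domain Y) (e : E) :
    IsWeakDeriv (u.1 e) (G.edgeDeriv u e) :=
  isWeakDeriv_weakDeriv (⟨u.1 e, u.2.1 e⟩ : sobolevH1 (G.len e) (G.k e))

theorem operator_apply {Y : ∀ v, Submodule ℂ (G.VertexSpace v)} (u : G.domain Y) :
    (G.operator Y).toFun u = G.mulOp G.M G.M_bounded (G.edgeDeriv u) +
      G.mulOp G.N G.N_bounded u.1 := rfl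

theorem mulOp_Q_operator {Y : ∀ v, Submodule ℂ (G.VertexSpace v)} (u : G.domain Y) :
    G.mulOp G.Q G.Q_bounded ((G.operator Y).toFun u) =
      G.mulOp (fun e x => G.Q e x * G.M e x) G.QM_bounded (G.edgeDeriv u) +
        G.mulOp G.Q G.Q_bounded (G.mulOp G.N G.N_bounded u.1) := by
  rw [operator_apply, map_add, mulOp_Q_mulOp_M]

/-- The defect of skew-symmetry `Q N + (Q N)^* - (Q M)'` of the operator. -/
def defect : G.L2 →L[ℂ] G.L2 :=
  G.mulOp G.Q G.Q_bounded ∘L G.mulOp G.N G.N_bounded +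
    ContinuousLinearMap.adjoint (G.mulOp G.Q G.Q_bounded ∘L G.mulOp G.N G.N_bounded) -
    G.mulOp (fun e => deriv fun x => G.Q e x * G.M e x) G.deriv_QM_bounded

theorem inner_defect (u v : G.L2) : inner ℂ (G.defect v) u =
    inner ℂ (G.mulOp G.Q G.Q_bounded (G.mulOp G.N G.N_bounded v)) u +
      inner ℂ v (G.mulOp G.Q G.Q_bounded (G.mulOp G.N G.N_bounded u)) -
      inner ℂ (G.mulOp (fun e => deriv fun x => G.Q e x * G.M e x) G.deriv_QM_bounded v) u := by
  rw [defect, _root_.sub_apply, _root_.add_apply, inner_sub_left, inner_add_left,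
    ContinuousLinearMap.adjoint_inner_left]
  rfl

theorem defect_eq_zero (h : G.IsEnergyConserving) : G.defect = 0 := by
  ext1 v
  refine ext_inner_right ℂ fun u => ?_
  rw [inner_defect, _root_.zero_apply, inner_zero_left, PiLp.inner_apply, PiLp.inner_apply,
    PiLp.inner_apply, ← Finset.sum_add_distrib, ← Finset.sum_sub_distrib]
  refine Finset.sum_eq_zero fun e _ => ?_
  simp only [mulOp_apply]
  rw [L2.inner_def, L2.inner_def, L2.inner_def, ← integral_add (L2.integrable_inner _ _)
    (L2.integrable_inner _ _), ← integral_sub ((L2.integrable_inner _ _).add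
    (L2.integrable_inner _ _)) (L2.integrable_inner _ _)]
  refine integral_eq_zero_of_ae ?_
  filter_upwards [h e, coeFn_mulL2 (G.N_bounded e) (v e),
    coeFn_mulL2 (G.N_bounded e) (u e), coeFn_mulL2 (G.Q_bounded e)
      (mulL2 (G.N e) (G.N_bounded e) (v e)), coeFn_mulL2 (G.Q_bounded e)
      (mulL2 (G.N e) (G.N_bounded e) (u e)), coeFn_mulL2 (G.deriv_QM_bounded e) (v e)]
    with x e1 e2 e3 e4 e5 e6
  rw [e4, e5, e6, e2, e3, e1.deriv, ← matOp_mul_apply, ← matOp_mul_apply, inner_matOp_right,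
    matOp_add_apply, inner_add_left, sub_self]
  rfl

section Boundary

variable [DecidableEq E] [DecidableEq V] [Fintype V]

/-- Integration by parts on all edges. -/
theorem inner_mulOp_add_inner_mulOp {u g v h : G.L2} (hug : ∀ e, IsWeakDeriv (u e) (g e))
    (hvh : ∀ e, IsWeakDeriv (v e) (h e)) {w z : ∀ e, ℝ → EuclideanSpace ℂ (Fin (G.k e))}
    (hw : ∀ e, IsContRep (u e) (w e)) (hz : ∀ e, IsContRep (v e) (z e)) :
    inner ℂ v (G.mulOp (fun e x => G.Q e x * G.M e x) G.QM_bounded g) +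
      inner ℂ (G.mulOp (fun e x => G.Q e x * G.M e x) G.QM_bounded h) u =
    ∑ a, inner ℂ (G.trace a z) (matOp (G.T a) (G.trace a w)) -
      inner ℂ (G.mulOp (fun e => deriv fun x => G.Q e x * G.M e x) G.deriv_QM_bounded v) u := by
  rw [sum_inner_trace_T, PiLp.inner_apply, PiLp.inner_apply, PiLp.inner_apply,
    ← Finset.sum_add_distrib, ← Finset.sum_sub_distrib]
  refine Finset.sum_congr rfl fun e _ => ?_
  obtain ⟨C, hC⟩ := G.exists_lipschitzOnWith_QM e
  exact inner_mulL2_add_inner_mulL2 (G.len_pos e) (hug e) (hvh e) hC (G.QM_bounded e)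
    (G.QM_hermitian e) (hw e) (hz e)

/-- On a domain given by isotropic boundary spaces, the operator is skew-symmetric for the energy up
to the defect. -/
theorem inner_operator_add_inner_operator {Y : ∀ v, Submodule ℂ (G.VertexSpace v)}
    (hY : ∀ v, G.IsTotallyIsotropic v (Y v)) (u v : G.domain Y) :
    inner ℂ v.1 (G.mulOp G.Q G.Q_bounded ((G.operator Y).toFun u)) +
      inner ℂ (G.mulOp G.Q G.Q_bounded ((G.operator Y).toFun v)) u.1 =
    inner ℂ (G.defect v.1) u.1 := by
  obtain ⟨-, w, hw, hwY⟩ := u.2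
  obtain ⟨-, z, hz, hzY⟩ := v.2
  have h1 := G.inner_mulOp_add_inner_mulOp (G.isWeakDeriv_edgeDeriv u) (G.isWeakDeriv_edgeDeriv v)
    hw hz
  rw [Finset.sum_eq_zero fun a _ =>
    inner_map_eq_zero_of_isotropic (matOp (G.T a)) (hY a) (hzY a) (hwY a), zero_sub] at h1
  rw [mulOp_Q_operator, mulOp_Q_operator, inner_add_left, inner_add_right, inner_defect]
  linear_combination h1

end Boundary

/-! ### Test functions in the domain -/

section TestFunctions

/-- Continuously differentiable functions satisfying the vertex conditions belong to the domain, and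
their weak derivatives are the classical ones. -/
theorem exists_domain_of_hasDerivAt {Y : ∀ v, Submodule ℂ (G.VertexSpace v)}
    {w w' : ∀ e, ℝ → EuclideanSpace ℂ (Fin (G.k e))} (hw : ∀ e x, HasDerivAt (w e) (w' e x) x)
    (hw' : ∀ e, Continuous (w' e)) (hY : ∀ v, G.trace v w ∈ Y v) :
    ∃ u : G.domain Y, (∀ e, IsContRep (u.1 e) (w e)) ∧
      ∀ e, G.edgeDeriv u e =ᵐ[volume.restrict (Ioo 0 (G.len e))] w' e := by
  have hc : ∀ e, Continuous (w e) := fun e =>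
    continuous_iff_continuousAt.2 fun x => (hw e x).continuousAt
  have hmem : ∀ (e : E) (f : ℝ → EuclideanSpace ℂ (Fin (G.k e))), Continuous f →
      ∃ g : IntervalL2 (G.len e) (G.k e), g =ᵐ[volume.restrict (Ioo 0 (G.len e))] f := by
    intro e f hf
    obtain ⟨C, hC⟩ := isCompact_Icc.exists_bound_of_continuousOn
      (hf.continuousOn (s := Icc 0 (G.len e)))
    have h1 : MemLp f 2 (volume.restrict (Ioo 0 (G.len e))) :=
      MemLp.of_bound hf.aestronglyMeasurable C ((ae_restrict_iff' measurableSet_Ioo).2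
        (Eventually.of_forall fun x hx => hC x (Ioo_subset_Icc_self hx)))
    exact ⟨h1.toLp f, h1.coeFn_toLp⟩
  choose u hu using fun e => hmem e (w e) (hc e)
  choose g hg using fun e => hmem e (w' e) (hw' e)
  have hug : ∀ e, IsWeakDeriv (u e) (g e) := fun e => by
    have h1 : AbsolutelyContinuousOnInterval (fun x => w e 0 + ∫ t in (0 : ℝ)..x, w' e t) 0
        (G.len e) :=
      (LipschitzWith.const (w e 0)).lipschitzOnWith.absolutelyContinuousOnInterval.add
        (((hw' e).intervalIntegrable 0 (G.len e)).absolutelyContinuousOnInterval_primitive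
          left_mem_uIcc)
    have h2 : (fun x => w e 0 + ∫ t in (0 : ℝ)..x, w' e t) = w e := funext fun x => by
      rw [intervalIntegral.integral_eq_sub_of_hasDerivAt (fun y _ => hw e y)
        ((hw' e).intervalIntegrable 0 x), add_sub_cancel]
    rw [h2] at h1
    refine h1.isWeakDeriv (G.len_pos e) (hu e) ?_
    filter_upwards [hg e] with x hx
    rw [hx]
    exact hw e x
  refine ⟨⟨WithLp.toLp 2 u, fun e => ⟨g e, hug e⟩, w, fun e => ⟨(hc e).continuousOn, hu e⟩, hY⟩,
    fun e => ⟨(hc e).continuousOn, hu e⟩, fun e => ?_⟩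
  rw [(G.isWeakDeriv_edgeDeriv _ e).unique (hug e)]
  exact hg e

/-- A test function on one edge, extended by zero. -/
theorem exists_domain_of_testFunction [DecidableEq E] (Y : ∀ v, Submodule ℂ (G.VertexSpace v))
    (e₀ : E) (ξ : EuclideanSpace ℂ (Fin (G.k e₀))) {φ : ℝ → ℝ} (h1 : ContDiff ℝ ∞ φ)
    (h3 : tsupport φ ⊆ Ioo 0 (G.len e₀)) :
    ∃ u : G.domain Y,
      (u.1 e₀ =ᵐ[volume.restrict (Ioo 0 (G.len e₀))] fun x => φ x • ξ) ∧
      (G.edgeDeriv u e₀ =ᵐ[volume.restrict (Ioo 0 (G.len e₀))] fun x => deriv φ x • ξ) ∧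
      ∀ e, e ≠ e₀ → u.1 e = 0 ∧ G.edgeDeriv u e = 0 := by
  let w : ∀ e, ℝ → EuclideanSpace ℂ (Fin (G.k e)) := Pi.single e₀ fun x => φ x • ξ
  let w' : ∀ e, ℝ → EuclideanSpace ℂ (Fin (G.k e)) := Pi.single e₀ fun x => deriv φ x • ξ
  have hw₀ : w e₀ = fun x => φ x • ξ := Pi.single_eq_same _ _
  have hw₀' : w' e₀ = fun x => deriv φ x • ξ := Pi.single_eq_same _ _
  have hne : ∀ e, e ≠ e₀ → w e = 0 := fun e he => Pi.single_eq_of_ne he _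
  have hne' : ∀ e, e ≠ e₀ → w' e = 0 := fun e he => Pi.single_eq_of_ne he _
  have hend : ∀ h : E × Bool, w h.1 (G.endPos h) = 0 := by
    rintro ⟨e, s⟩
    rcases eq_or_ne e e₀ with rfl | he
    · have h4 : G.endPos (e, s) ∉ tsupport φ := fun h => by
        have h5 := h3 h
        cases s
        · exact lt_irrefl _ h5.1
        · exact lt_irrefl _ h5.2
      simp only [hw₀, image_eq_zero_of_notMem_tsupport h4, zero_smul]
    · simp only [hne e he, Pi.zero_apply]
  obtain ⟨u, hu, hu'⟩ := G.exists_domain_of_hasDerivAt (Y := Y) (w := w) (w' := w')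
    (fun e x => by
      rcases eq_or_ne e e₀ with rfl | he
      · rw [hw₀, hw₀']
        exact (h1.differentiable (by simp) x).hasDerivAt.smul_const ξ
      · rw [hne e he, hne' e he]
        exact hasDerivAt_const x 0)
    (fun e => by
      rcases eq_or_ne e e₀ with rfl | he
      · rw [hw₀']
        exact (h1.continuous_deriv (by simp)).smul continuous_const
      · rw [hne' e he]
        exact continuous_const)
    (fun v => by
      have : G.trace v w = 0 := by
        ext i
        change w i.1.1.1 (G.endPos i.1.1) i.2 = 0
        rw [hend]
        rfl
      rw [this]
      exact (Y v).zero_mem)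
  refine ⟨u, hw₀ ▸ (hu e₀).2, hw₀' ▸ hu' e₀, fun e he => ⟨?_, ?_⟩⟩
  · exact Lp.eq_zero_iff_ae_eq_zero.2 (hne e he ▸ (hu e).2)
  · exact Lp.eq_zero_iff_ae_eq_zero.2 (hne' e he ▸ hu' e)

/-- Prescribed boundary values are attained by functions which are affine on each edge. -/
theorem exists_domain_of_trace {Y : ∀ v, Submodule ℂ (G.VertexSpace v)}
    (ξ : ∀ v, G.VertexSpace v) (hξ : ∀ v, ξ v ∈ Y v) :
    ∃ (u : G.domain Y) (w : ∀ e, ℝ → EuclideanSpace ℂ (Fin (G.k e))),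
      (∀ e, IsContRep (u.1 e) (w e)) ∧ ∀ v, G.trace v w = ξ v := by
  let b : ∀ h : E × Bool, EuclideanSpace ℂ (Fin (G.k h.1)) := fun h =>
    WithLp.toLp 2 fun i => ξ (G.endVertex h) ⟨⟨h, rfl⟩, i⟩
  let w : ∀ e, ℝ → EuclideanSpace ℂ (Fin (G.k e)) := fun e x =>
    b (e, false) + (x / G.len e) • (b (e, true) - b (e, false))
  let w' : ∀ e, ℝ → EuclideanSpace ℂ (Fin (G.k e)) := fun e _ =>
    (1 / G.len e) • (b (e, true) - b (e, false))
  have hend : ∀ h : E × Bool, w h.1 (G.endPos h) = b h := by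
    rintro ⟨e, s⟩
    cases s
    · simp [w, endPos]
    · simp [w, endPos, div_self (G.len_pos e).ne']
  have htr : ∀ v, G.trace v w = ξ v := by
    intro v
    ext i
    obtain ⟨⟨h, rfl⟩, i⟩ := i
    change w h.1 (G.endPos h) i = ξ (G.endVertex h) ⟨⟨h, rfl⟩, i⟩
    rw [hend]
  obtain ⟨u, hu, -⟩ := G.exists_domain_of_hasDerivAt (Y := Y) (w := w) (w' := w')
    (fun e x => (((hasDerivAt_id x).div_const (G.len e)).smul_const _).const_add _)
    (fun e => continuous_const) (fun v => by rw [htr]; exact hξ v)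
  exact ⟨u, w, hu, htr⟩

end TestFunctions

/-! ### The domain of the adjoint -/

section Adjoint

variable [DecidableEq E]

/-- Testing with functions supported inside one edge shows that `Q M x` is weakly differentiable. -/
theorem isWeakDeriv_mulL2_QM {Y : ∀ v, Submodule ℂ (G.VertexSpace v)} {x y : G.L2}
    (hxy : ∀ u : G.domain Y, inner ℂ x (G.mulOp (fun e x => G.Q e x * G.M e x) G.QM_bounded
      (G.edgeDeriv u)) = inner ℂ y u.1) (e : E) :
    IsWeakDeriv (mulL2 (fun x => G.Q e x * G.M e x) (G.QM_bounded e) (x e)) (-y e) := by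
  intro φ h1 h2 h3
  have hd : Continuous (deriv φ) := h1.continuous_deriv (by simp)
  refine ext_inner_right ℂ fun ξ => ?_
  obtain ⟨u, hu, hu', h0⟩ := G.exists_domain_of_testFunction Y e ξ h1 h3
  have key := hxy u
  rw [← G.inner_mulOp_comm _ G.QM_bounded G.QM_hermitian, PiLp.inner_apply, PiLp.inner_apply,
    Finset.sum_eq_single e (fun e' _ he' => by rw [(h0 e' he').2, inner_zero_right])
      (fun he => absurd (Finset.mem_univ e) he),
    Finset.sum_eq_single e (fun e' _ he' => by rw [(h0 e' he').1, inner_zero_right])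
      (fun he => absurd (Finset.mem_univ e) he), mulOp_apply] at key
  have hpair : ∀ (f g : IntervalL2 (G.len e) (G.k e)) (ψ : ℝ → ℝ), Continuous ψ →
      HasCompactSupport ψ → (g =ᵐ[volume.restrict (Ioo 0 (G.len e))] fun x => ψ x • ξ) →
      inner ℂ f g = inner ℂ (∫ x in Ioo 0 (G.len e), ψ x • f x) ξ := by
    intro f g ψ hψ hψ' hg
    rw [← inner_conj_symm _ ξ, ← integral_inner (integrable_smul_L2 f hψ hψ'), ← integral_conj,
      L2.inner_def]
    refine integral_congr_ae ?_
    filter_upwards [hg] with t ht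
    rw [ht, inner_conj_symm, inner_smul_left_eq_smul, inner_smul_right_eq_smul]
  have hneg : ∫ x in Ioo 0 (G.len e), φ x • (-y e) x =
      -∫ x in Ioo 0 (G.len e), φ x • y e x := by
    rw [← integral_neg]
    refine integral_congr_ae ?_
    filter_upwards [Lp.coeFn_neg (y e)] with t ht
    rw [ht, Pi.neg_apply, smul_neg]
  rw [hneg, neg_neg, ← hpair _ _ _ hd h2.deriv hu', ← hpair _ _ _ h1.continuous h2 hu, key]

variable [DecidableEq V] [Fintype V]

/-- The adjoint of the operator has the same domain: an element of its domain is in `H¹`, and its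
boundary values are orthogonal to `T Y`, hence belong to `T⁻¹ Y^⊥ ⊆ Y`. -/
theorem exists_domain_of_inner_operator {Y : ∀ v, Submodule ℂ (G.VertexSpace v)}
    (hY' : ∀ v, G.IsTotallyIsotropic v (G.dualBoundarySpace v (Y v))) {x y : G.L2}
    (hxy : ∀ u : G.domain Y, inner ℂ x (G.mulOp G.Q G.Q_bounded ((G.operator Y).toFun u)) =
      inner ℂ y u.1) :
    ∃ v : G.domain Y, v.1 = x ∧
      G.mulOp G.Q G.Q_bounded ((G.operator Y).toFun v) = G.defect x - y := by
  set R := G.mulOp G.Q G.Q_bounded ∘L G.mulOp G.N G.N_bounded with hR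
  obtain ⟨y', hy'⟩ : ∃ y', y' = y - ContinuousLinearMap.adjoint R x := ⟨_, rfl⟩
  have hxy' : ∀ u : G.domain Y, inner ℂ x (G.mulOp (fun e x => G.Q e x * G.M e x) G.QM_bounded
      (G.edgeDeriv u)) = inner ℂ y' u.1 := fun u => by
    have h1 := hxy u
    rw [mulOp_Q_operator, inner_add_right] at h1
    rw [hy', inner_sub_left, ContinuousLinearMap.adjoint_inner_left, ← h1]
    exact (add_sub_cancel_right _ _).symm
  have hweak := G.isWeakDeriv_mulL2_QM hxy'
  have hH1 : ∀ e, x e ∈ sobolevH1 (G.len e) (G.k e) := fun e =>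
    G.mem_sobolevH1_of_isWeakDeriv (hweak e)
  choose g hg using hH1
  choose z hz1 hz2 hz3 using fun e => (hg e).exists_absolutelyContinuous (G.len_pos e)
  have hz : ∀ e, IsContRep (x e) (z e) := fun e =>
    (hz1 e).isContRep (G.len_pos e) (hz2 e)
  have hprod : G.mulOp (fun e => deriv fun x => G.Q e x * G.M e x) G.deriv_QM_bounded x +
      G.mulOp (fun e x => G.Q e x * G.M e x) G.QM_bounded (WithLp.toLp 2 g) = -y' := by
    ext1 e
    obtain ⟨C, hC⟩ := G.exists_lipschitzOnWith_QM e
    exact ((hg e).mulL2 (G.len_pos e) hC (G.QM_bounded e)).unique (hweak e)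
  have hbdry : ∀ (u : G.domain Y) (w : ∀ e, ℝ → EuclideanSpace ℂ (Fin (G.k e))),
      (∀ e, IsContRep (u.1 e) (w e)) →
        ∑ a, inner ℂ (G.trace a z) (matOp (G.T a) (G.trace a w)) = 0 := by
    intro u w hw
    have h1 := G.inner_mulOp_add_inner_mulOp (h := WithLp.toLp 2 g) (G.isWeakDeriv_edgeDeriv u) hg
      hw hz
    have h2 := congrArg (fun f => inner ℂ f u.1) hprod
    simp only [inner_add_left, inner_neg_left] at h2
    rw [hxy'] at h1
    linear_combination h2 - h1
  have htrace : ∀ a, G.trace a z ∈ Y a := by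
    intro a
    refine G.dualBoundarySpace_le (hY' a) ?_
    have horth : matOp (G.T a) (G.trace a z) ∈ (Y a)ᗮ := by
      rw [Submodule.mem_orthogonal']
      intro η hη
      obtain ⟨u, w, hw, htr⟩ := G.exists_domain_of_trace (Y := Y) (Pi.single a η) fun v => by
        rcases eq_or_ne v a with rfl | hv
        · rwa [Pi.single_eq_same]
        · rw [Pi.single_eq_of_ne hv]
          exact (Y v).zero_mem
      -- `u` has the boundary values `η` at `a` and `0` at the other vertices
      have h1 := hbdry u w hw
      rw [Finset.sum_eq_single a (fun v _ hv => by
        rw [htr, Pi.single_eq_of_ne hv, map_zero, inner_zero_right])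
        (fun ha => absurd (Finset.mem_univ a) ha), htr, Pi.single_eq_same, inner_matOp_right,
        G.T_isHermitian a] at h1
      exact h1
    refine ⟨_, horth, ?_⟩
    change matOp (G.T a)⁻¹ (matOp (G.T a) (G.trace a z)) = G.trace a z
    rw [← matOp_mul_apply, G.inv_mul_T, matOp_one_apply]
  refine ⟨⟨x, fun e => ⟨g e, hg e⟩, z, hz, htrace⟩, rfl, ?_⟩
  have hder : G.edgeDeriv (⟨x, fun e => ⟨g e, hg e⟩, z, hz, htrace⟩ : G.domain Y) =
      WithLp.toLp 2 g := by
    ext1 e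
    exact (G.isWeakDeriv_edgeDeriv _ e).unique (hg e)
  rw [mulOp_Q_operator, hder, defect, _root_.sub_apply, _root_.add_apply, ← hR]
  change _ + R x = R x + ContinuousLinearMap.adjoint R x - _ - y
  have h3 := eq_sub_of_add_eq' hprod
  rw [h3, hy']
  abel

/-- The operator, transported to a Hilbert space whose inner product is the energy, is
quasi-skew-adjoint. -/
theorem exists_isQuasiSkewAdjoint [Nonempty E] {Y : ∀ v, Submodule ℂ (G.VertexSpace v)}
    (hY : ∀ v, G.IsTotallyIsotropic v (Y v))
    (hY' : ∀ v, G.IsTotallyIsotropic v (G.dualBoundarySpace v (Y v))) :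
    ∃ (e : G.L2 ≃L[ℂ] G.L2) (k : ℝ), (∀ u v, G.energyInner u v = inner ℂ (e v) (e u)) ∧
      IsQuasiSkewAdjoint (e.toLinearEquiv.toLinearMap ∘ₗ (G.operator Y).domain.subtype)
        (e.toLinearEquiv.toLinearMap ∘ₗ (G.operator Y).toFun) k ∧
      (G.IsEnergyConserving → k = 0) := by
  obtain ⟨c, hc, hcP⟩ := G.exists_le_re_inner_mulOp_Q
  obtain ⟨e, he⟩ := G.isPositive_mulOp_Q.exists_inner_equiv hc hcP
  refine ⟨e, _, fun u v => by rw [energyInner_eq, he],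
    IsQuasiSkewAdjoint.of_form (K := G.defect) he Subtype.val_injective
      (fun u v => G.inner_operator_add_inner_operator hY u v)
      (fun x y h => G.exists_domain_of_inner_operator hY' h), fun h => ?_⟩
  rw [G.defect_eq_zero h, ContinuousLinearMap.zero_comp, ContinuousLinearMap.comp_zero, norm_zero]

end Adjoint

end HyperbolicNetwork

end

/-! ### Quasi-m-dissipativity and generation -/

/-- Quasi-skew-adjoint operators are quasi-m-dissipative for the transported inner product. -/
theorem IsQuasiSkewAdjoint.isQuasiMDissipative {X H : Type*} [AddCommGroup X] [Module ℂ X]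
    [NormedAddCommGroup H] [InnerProductSpace ℂ H] {B : X → X → ℂ} {e : X ≃ₗ[ℂ] H}
    (hB : ∀ u v, B u v = inner ℂ (e v) (e u)) {A : X →ₗ.[ℂ] X} {k : ℝ}
    (h : IsQuasiSkewAdjoint (e.toLinearMap ∘ₗ A.domain.subtype) (e.toLinearMap ∘ₗ A.toFun) k) :
    IsQuasiMDissipative B A := by
  refine ⟨k, fun u => ?_, fun r hr f => ?_⟩
  · have h1 := abs_re_inner_le h.bound u
    have h2 := le_abs_self (inner ℂ (e u) (e (A u))).re
    have h3 : (B u u).re = ‖e u‖ ^ 2 := by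
      rw [hB, inner_self_eq_norm_sq_to_K]
      norm_cast
    rw [h3, hB]
    change 2 * |(inner ℂ (e u) (e (A u))).re| ≤ k * ‖e u‖ ^ 2 at h1
    nlinarith [abs_nonneg (inner ℂ (e u) (e (A u))).re]
  · obtain ⟨u, hu⟩ := h.surj r (hr.trans_le (le_abs_self r)) (e f)
    refine ⟨u, e.injective ?_⟩
    rw [map_sub, map_smul]
    exact hu

theorem mainTheorem3 {V E : Type*} [Fintype V] [Fintype E] [Nonempty E]
    [DecidableEq V] [DecidableEq E] (G : HyperbolicNetwork V E)
    (Y : ∀ v : V, Submodule ℂ (G.VertexSpace v))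
    (hY : ∀ v, G.IsTotallyIsotropic v (Y v))
    (hY' : ∀ v, G.IsTotallyIsotropic v (G.dualBoundarySpace v (Y v))) :
    IsQuasiMDissipative G.energyInner (G.operator Y) ∧
    IsQuasiMDissipative G.energyInner (-G.operator Y) ∧
    (∃ S : C0Semigroup G.L2, S.IsGenerator (G.operator Y)) ∧
    (∃ S : C0Semigroup G.L2, S.IsGenerator (-G.operator Y)) ∧
    ∃ S : C0Group G.L2, S.IsGenerator (G.operator Y) ∧
      (G.IsEnergyConserving →
        ∀ (t : ℝ) (u v : G.L2), G.energyInner (S.op t u) (S.op t v) = G.energyInner u v) := by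
  obtain ⟨e, k, he, hA, hk⟩ := G.exists_isQuasiSkewAdjoint hY hY'
  have hneg : IsQuasiSkewAdjoint (e.toLinearEquiv.toLinearMap ∘ₗ (-G.operator Y).domain.subtype)
      (e.toLinearEquiv.toLinearMap ∘ₗ (-G.operator Y).toFun) k := by
    have h1 : e.toLinearEquiv.toLinearMap ∘ₗ (-G.operator Y).toFun =
        -(e.toLinearEquiv.toLinearMap ∘ₗ (G.operator Y).toFun) :=
      LinearMap.comp_neg _ _
    rw [h1]
    exact hA.neg
  obtain ⟨h1, h2, S, hS, hSb⟩ := exists_generated_groups e (G.operator Y) hA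
  refine ⟨hA.isQuasiMDissipative (e := e.toLinearEquiv) he,
    hneg.isQuasiMDissipative (e := e.toLinearEquiv) he, h1, h2, S, hS, fun hG t u v => ?_⟩
  rw [hk hG] at hSb
  simp only [zero_mul, Real.exp_zero, one_mul] at hSb
  -- a group of contractions consists of isometries
  have hiso : ∀ x, ‖e (S.op t (e.symm x))‖ = ‖x‖ := fun x => by
    refine le_antisymm ((hSb t _).trans_eq (by rw [e.apply_symm_apply])) ?_
    have h3 := hSb (-t) (S.op t (e.symm x))
    have h4 : S.op (-t) (S.op t (e.symm x)) = e.symm x := by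
      have h5 := S.op_add (-t) t
      rw [neg_add_cancel, S.op_zero] at h5
      exact (congrArg (fun T : G.L2 →L[ℂ] G.L2 => T (e.symm x)) h5).symm
    rwa [h4, e.apply_symm_apply] at h3
  have hinner := (LinearMap.norm_map_iff_inner_map_map
    ((e : G.L2 →L[ℂ] G.L2) ∘L S.op t ∘L (e.symm : G.L2 →L[ℂ] G.L2))).1 hiso (e v) (e u)
  rw [he, he, ← hinner]
  simp
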